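/- **Theorem 6.4.** Let $k\ge 3$, let $\mathbb B$ be the Bethe lattice of coordination number $k$ (the infinite $k$-regular tree) with vertex set $\mathcal V$ and a distinguished vertex $0$, and let $\mu$ be an arbitrary Borel probability measure on $[-1,1]$. For $\lambda\ge 0$ and $\omega\in[-1,1]^{\mathcal V}$ let $H_\omega(\lambda)$ be the bounded self-adjoint operator on $\ell^2(\mathcal V)$ given by $$(H_\omega(\lambda)\psi)(x)=\sum_{y\sim x}\psi(y)+\lambda\,\omega_x\psi(x),$$ where the $\omega_x$ are i.i.d. with law $\mu$. Let the density of states measure $n_\lambda$ be defined by $n_\lambda(f)=\mathbb E\,\mathrm{Tr}(\pi_0 f(H_\omega(\lambda))\pi_0)=\mathbb E\,\langle\delta_0,f(H_\omega(\lambda))\delta_0\rangle$, where $\pi_0=|\delta_0\rangle\langle\delta_0|$, and let $N_\lambda(E)=n_\lambda((-\infty,E))$ be the integrated density of states. Put $$\xi_0=\frac{2e}{1+2e},\qquad \lambda_{\mathbb B}=e^{-3\log(k)/\xi_0},\qquad I=[-2\sqrt{k-1}-\lambda_{\mathbb B},\,2\sqrt{k-1}+\lambda_{\mathbb B}],$$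 $$c_b=\frac{4306+837\sqrt6}{5832},\qquad \widetilde\gamma_{\mathbb B}=2\bigl(2(2\sqrt k+\lambda_{\mathbb B})\,c_b\sqrt{\log k}+1\bigr),\qquad \widetilde c_{\mathbb B}=\widetilde\gamma_{\mathbb B}+c_{\mathbb B},$$ $$c_{\mathbb B}=\frac{k}{4\pi\sqrt{k^2-4(k-1)}}\ \text{ if } 3\le k\le 6,\qquad c_{\mathbb B}=\frac{\sqrt{4(k-1)}}{2\pi k}\ \text{ if } k\ge 7,$$ and, for a real-valued Lipschitz function $f$ on $I$, $\|f\|_{\mathrm{Lip}}=\sup_{x\in I}|f(x)|+\sup_{x\ne y\in I}\frac{|f(x)-f(y)|}{|x-y|}$. Then for all $0<\lambda\le\lambda_{\mathbb B}$: (i) for every Lipschitz function $f:I\to\mathbb R$, $$|n_\lambda(f)-n_0(f)|\le\frac{\widetilde\gamma_{\mathbb B}\,\|f\|_{\mathrm{Lip}}}{\sqrt{\log(\lambda^{-2e/(1+2e)})}};$$ (ii) for every $E\in\mathbb R$, $$|N_\lambda(E)-N_0(E)|\le\frac{\widetilde c_{\mathbb B}}{\bigl(\log(\lambda^{-2e/(1+2e)})\bigr)^{1/4}}.$$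 -/

import Mathlib

open MeasureTheory
open scoped ENNReal

noncomputable section

namespace BetheAnderson

/-- The Hilbert space `ℓ²(V)` of square-summable complex functions on the vertex set. -/
abbrev Ell2 (V : Type*) : Type _ := lp (fun _ : V => ℂ) 2

/-- The standard basis vector `δ_o ∈ ℓ²(V)`. -/
def delta {V : Type*} (o : V) : Ell2 V :=
  haveI := Classical.decEq V
  lp.single 2 o (1 : ℂ)

/-- Configurations `ω ∈ Ω = [-1, 1]^V`. -/
abbrev Config (V : Type*) : Type _ := V → Set.Icc (-1 : ℝ) 1

theorem sum_sq_le {V : Type*} (ψ : Ell2 V) (s : Finset V) :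
    ∑ x ∈ s, ‖ψ x‖ ^ 2 ≤ ‖ψ‖ ^ 2 := by
  have h := lp.sum_rpow_le_norm_rpow (p := 2) (by norm_num) ψ s
  simpa using h

theorem memLp_of_sum_sq_le {V : Type*} {φ : V → ℂ} {C : ℝ}
    (h : ∀ s : Finset V, ∑ x ∈ s, ‖φ x‖ ^ 2 ≤ C) :
    Memℓp (E := fun _ : V => ℂ) φ 2 :=
  memℓp_gen' (C := C) fun s => by simpa using h s

theorem norm_le_of_sum_sq_le {V : Type*} {φ : Ell2 V} {C : ℝ} (hC : 0 ≤ C)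
    (h : ∀ s : Finset V, ∑ x ∈ s, ‖φ x‖ ^ 2 ≤ C ^ 2) : ‖φ‖ ≤ C :=
  lp.norm_le_of_forall_sum_le (p := 2) (by norm_num) hC fun s => by simpa using h s

theorem laplacian_sum_sq_le {V : Type*} {G : SimpleGraph V} [G.LocallyFinite] {k : ℕ}
    (hreg : G.IsRegularOfDegree k) (ψ : Ell2 V) (s : Finset V) :
    ∑ x ∈ s, ‖∑ y ∈ G.neighborFinset x, ψ y‖ ^ 2 ≤ ((k : ℝ) * ‖ψ‖) ^ 2 := by
  classical
  have h1 : ∀ x ∈ s, ‖∑ y ∈ G.neighborFinset x, ψ y‖ ^ 2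
      ≤ k * ∑ y ∈ G.neighborFinset x, ‖ψ y‖ ^ 2 := by
    intro x _
    calc ‖∑ y ∈ G.neighborFinset x, ψ y‖ ^ 2
        ≤ (∑ y ∈ G.neighborFinset x, ‖ψ y‖) ^ 2 := by
          gcongr
          exact norm_sum_le _ _
      _ ≤ (G.neighborFinset x).card * ∑ y ∈ G.neighborFinset x, ‖ψ y‖ ^ 2 :=
          sq_sum_le_card_mul_sum_sq
      _ = k * ∑ y ∈ G.neighborFinset x, ‖ψ y‖ ^ 2 := by
          rw [G.card_neighborFinset_eq_degree, hreg x]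
  have h2 : ∑ x ∈ s, ∑ y ∈ G.neighborFinset x, ‖ψ y‖ ^ 2
      = ∑ y ∈ s.biUnion (fun x => G.neighborFinset x),
          ∑ _x ∈ s.filter (fun x => G.Adj y x), ‖ψ y‖ ^ 2 := by
    apply Finset.sum_comm'
    intro x y
    simp only [SimpleGraph.mem_neighborFinset, Finset.mem_filter, Finset.mem_biUnion]
    constructor
    · rintro ⟨hx, hxy⟩
      exact ⟨⟨hx, hxy.symm⟩, x, hx, hxy⟩
    · rintro ⟨⟨hx, hxy⟩, -⟩
      exact ⟨hx, hxy.symm⟩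
  have h3 : ∀ y, ∑ _x ∈ s.filter (fun x => G.Adj y x), ‖ψ y‖ ^ 2 ≤ k * ‖ψ y‖ ^ 2 := by
    intro y
    rw [Finset.sum_const, nsmul_eq_mul]
    have : (s.filter (fun x => G.Adj y x)).card ≤ k := by
      rw [← hreg y, ← G.card_neighborFinset_eq_degree]
      apply Finset.card_le_card
      intro x hx
      simpa using (Finset.mem_filter.1 hx).2
    gcongr
  calc ∑ x ∈ s, ‖∑ y ∈ G.neighborFinset x, ψ y‖ ^ 2
      ≤ ∑ x ∈ s, k * ∑ y ∈ G.neighborFinset x, ‖ψ y‖ ^ 2 := Finset.sum_le_sum h1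
    _ = k * ∑ y ∈ s.biUnion (fun x => G.neighborFinset x),
          ∑ _x ∈ s.filter (fun x => G.Adj y x), ‖ψ y‖ ^ 2 := by
        rw [← Finset.mul_sum, h2]
    _ ≤ k * ∑ y ∈ s.biUnion (fun x => G.neighborFinset x), k * ‖ψ y‖ ^ 2 := by
        gcongr with y hy
        exact h3 y
    _ ≤ k * (k * ‖ψ‖ ^ 2) := by
        rw [← Finset.mul_sum]
        gcongr
        exact sum_sq_le ψ _
    _ = ((k : ℝ) * ‖ψ‖) ^ 2 := by ring

/-- The graph Laplacian `(Δ ψ)(x) = ∑_{y ∼ x} ψ(y)` of a `k`-regular graph, as a bounded operator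
on `ℓ²(V)`. -/
def laplacian {V : Type*} {G : SimpleGraph V} [G.LocallyFinite] {k : ℕ}
    (hreg : G.IsRegularOfDegree k) : Ell2 V →L[ℂ] Ell2 V :=
  LinearMap.mkContinuous
    { toFun := fun ψ => ⟨fun x => ∑ y ∈ G.neighborFinset x, ψ y,
        memLp_of_sum_sq_le (laplacian_sum_sq_le hreg ψ)⟩
      map_add' := fun ψ φ => by
        ext x
        exact Finset.sum_add_distrib
      map_smul' := fun c ψ => by
        ext x
        simp [Finset.mul_sum] }
    k
    (fun ψ => norm_le_of_sum_sq_le (by positivity) (laplacian_sum_sq_le hreg ψ))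

theorem laplacian_apply {V : Type*} {G : SimpleGraph V} [G.LocallyFinite] {k : ℕ}
    (hreg : G.IsRegularOfDegree k) (ψ : Ell2 V) (x : V) :
    laplacian hreg ψ x = ∑ y ∈ G.neighborFinset x, ψ y := rfl

theorem potential_sum_sq_le {V : Type*} (ω : Config V) (ψ : Ell2 V) (s : Finset V) :
    ∑ x ∈ s, ‖((ω x : ℝ) : ℂ) * ψ x‖ ^ 2 ≤ (1 * ‖ψ‖) ^ 2 := by
  rw [one_mul]
  refine le_trans (Finset.sum_le_sum fun x _ => ?_) (sum_sq_le ψ s)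
  have : |(ω x : ℝ)| ≤ 1 := abs_le.2 ⟨(ω x).2.1, (ω x).2.2⟩
  rw [norm_mul, Complex.norm_real, Real.norm_eq_abs]
  gcongr
  exact mul_le_of_le_one_left (norm_nonneg _) this

/-- The random potential `∑_x ω_x π_x`, i.e. multiplication by `ω`, as a bounded operator
on `ℓ²(V)`. -/
def potential {V : Type*} (ω : Config V) : Ell2 V →L[ℂ] Ell2 V :=
  LinearMap.mkContinuous
    { toFun := fun ψ => ⟨fun x => ((ω x : ℝ) : ℂ) * ψ x,
        memLp_of_sum_sq_le (potential_sum_sq_le ω ψ)⟩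
      map_add' := fun ψ φ => by
        ext x
        exact mul_add _ _ _
      map_smul' := fun c ψ => by
        ext x
        simp [mul_left_comm] }
    1
    (fun ψ => norm_le_of_sum_sq_le (by positivity) (potential_sum_sq_le ω ψ))

theorem potential_apply {V : Type*} (ω : Config V) (ψ : Ell2 V) (x : V) :
    potential ω ψ x = ((ω x : ℝ) : ℂ) * ψ x := rfl

/-- The Anderson Hamiltonian `H_ω(lam) = Δ + lam ∑_x ω_x π_x`. -/
def hamiltonian {V : Type*} {G : SimpleGraph V} [G.LocallyFinite] {k : ℕ}
    (hreg : G.IsRegularOfDegree k) (lam : ℝ) (ω : Config V) : Ell2 V →L[ℂ] Ell2 V :=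
  laplacian hreg + (lam : ℂ) • potential ω

theorem hamiltonian_apply {V : Type*} {G : SimpleGraph V} [G.LocallyFinite] {k : ℕ}
    (hreg : G.IsRegularOfDegree k) (lam : ℝ) (ω : Config V) (ψ : Ell2 V) (x : V) :
    hamiltonian hreg lam ω ψ x
      = ∑ y ∈ G.neighborFinset x, ψ y + (lam : ℂ) * (((ω x : ℝ) : ℂ) * ψ x) := rfl

theorem norm_hamiltonian_le {V : Type*} {G : SimpleGraph V} [G.LocallyFinite] {k : ℕ}
    (hreg : G.IsRegularOfDegree k) (lam : ℝ) (ω : Config V) :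
    ‖hamiltonian hreg lam ω‖ ≤ k + |lam| := by
  have h1 : ‖laplacian hreg‖ ≤ k := LinearMap.mkContinuous_norm_le _ (by positivity) _
  have h2 : ‖potential ω‖ ≤ 1 := LinearMap.mkContinuous_norm_le _ (by positivity) _
  refine (norm_add_le _ _).trans (add_le_add h1 ?_)
  rw [norm_smul, Complex.norm_real, Real.norm_eq_abs]
  exact mul_le_of_le_one_right (abs_nonneg _) h2

theorem inner_delta_left {V : Type*} (o : V) (ψ : Ell2 V) :
    inner ℂ (delta o) ψ = ψ o := by
  classical
  rw [delta, lp.inner_single_left]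
  simp

theorem norm_delta {V : Type*} (o : V) : ‖delta o‖ = 1 := by
  classical
  rw [delta, lp.norm_single (by norm_num)]
  simp

theorem delta_apply {V : Type*} [inst : DecidableEq V] (o x : V) :
    delta o x = if x = o then 1 else 0 := by
  obtain rfl : inst = Classical.decEq V := Subsingleton.elim _ _
  letI := Classical.decEq V
  rw [delta, lp.single_apply]
  by_cases h : x = o <;> simp [h]

theorem isSelfAdjoint_hamiltonian {V : Type*} {G : SimpleGraph V} [G.LocallyFinite] {k : ℕ}
    (hreg : G.IsRegularOfDegree k) (lam : ℝ) (ω : Config V) :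
    IsSelfAdjoint (hamiltonian hreg lam ω) := by
  classical
  rw [ContinuousLinearMap.isSelfAdjoint_iff']
  set H := hamiltonian hreg lam ω with hH
  have key : ∀ y, ContinuousLinearMap.adjoint H (delta y) = H (delta y) := by
    intro y
    ext x
    rw [← inner_delta_left x, ContinuousLinearMap.adjoint_inner_right,
      ← inner_conj_symm, inner_delta_left, hH, hamiltonian_apply, hamiltonian_apply]
    simp only [delta_apply, Finset.sum_ite_eq', SimpleGraph.mem_neighborFinset]
    rw [G.adj_comm y x]
    by_cases hxy : x = y
    · subst hxy
      simp
    · have hyx : ¬ y = x := fun h => hxy h.symm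
      by_cases ha : G.Adj x y <;> simp [hxy, hyx, ha]
  refine lp.ext_continuousLinearMap (by norm_num) fun y => ?_
  have hd : delta y = lp.single (E := fun _ : V => ℂ) 2 y (1 : ℂ) := by
    ext x
    rw [delta_apply, lp.single_apply]
    by_cases h : x = y <;> simp [h]
  ext1
  simpa [hd] using key y

/-- The matrix element `⟨ψ, f(A) ψ⟩`, where `f(A)` is the continuous functional calculus of the
bounded self-adjoint operator `A` (it only involves the values of `f` on the spectrum of `A`). -/
def matrixElement {E : Type*} [NormedAddCommGroup E] [InnerProductSpace ℂ E] [CompleteSpace E]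
    (A : E →L[ℂ] E) (ψ : E) (f : ℝ → ℝ) : ℝ :=
  (inner ℂ ψ (cfc f A ψ)).re

theorem spectrum_subset {E : Type*} [NormedAddCommGroup E] [InnerProductSpace ℂ E]
    [CompleteSpace E] (A : E →L[ℂ] E) {R : ℝ} (hA : ‖A‖ ≤ R) :
    spectrum ℝ A ⊆ Set.Icc (-R) R := by
  intro x hx
  rcases subsingleton_or_nontrivial E with h | h
  · have : Subsingleton (E →L[ℂ] E) := ⟨fun a b => by
      ext1 v
      exact Subsingleton.elim _ _⟩
    simp [spectrum.of_subsingleton] at hx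
  · have h1 : ‖x‖ ≤ ‖A‖ := spectrum.norm_le_norm_of_mem hx
    exact abs_le.1 (h1.trans hA)

theorem abs_matrixElement_le {E : Type*} [NormedAddCommGroup E] [InnerProductSpace ℂ E]
    [CompleteSpace E] (A : E →L[ℂ] E) {ψ : E} (hψ : ‖ψ‖ = 1) {R C : ℝ} (hA : ‖A‖ ≤ R)
    (hC : 0 ≤ C) {f : ℝ → ℝ} (hf : ∀ x ∈ Set.Icc (-R) R, |f x| ≤ C) :
    |matrixElement A ψ f| ≤ C := by
  have h1 : ‖cfc f A‖ ≤ C := norm_cfc_le hC fun x hx => hf x (spectrum_subset A hA hx)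
  refine (Complex.abs_re_le_norm _).trans ((norm_inner_le_norm _ _).trans ?_)
  rw [hψ, one_mul]
  refine (ContinuousLinearMap.le_opNorm _ _).trans ?_
  rwa [hψ, mul_one]

theorem matrixElement_add {E : Type*} [NormedAddCommGroup E] [InnerProductSpace ℂ E]
    [CompleteSpace E] (A : E →L[ℂ] E) (ψ : E) {f g : ℝ → ℝ} (hf : Continuous f)
    (hg : Continuous g) :
    matrixElement A ψ (fun x => f x + g x) = matrixElement A ψ f + matrixElement A ψ g := by
  rw [matrixElement, cfc_add A f g hf.continuousOn hg.continuousOn, add_apply,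
    inner_add_right, Complex.add_re]
  rfl

theorem matrixElement_const_mul {E : Type*} [NormedAddCommGroup E] [InnerProductSpace ℂ E]
    [CompleteSpace E] (A : E →L[ℂ] E) (ψ : E) (c : ℝ) {f : ℝ → ℝ} (hf : Continuous f) :
    matrixElement A ψ (fun x => c * f x) = c * matrixElement A ψ f := by
  rw [matrixElement, cfc_const_mul c f _ hf.continuousOn, smul_apply,
    inner_smul_right_eq_smul, Complex.real_smul, Complex.re_ofReal_mul]
  rfl

theorem matrixElement_nonneg {E : Type*} [NormedAddCommGroup E] [InnerProductSpace ℂ E]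
    [CompleteSpace E] (A : E →L[ℂ] E) (ψ : E) {f : ℝ → ℝ} (hf : ∀ x, 0 ≤ f x) :
    0 ≤ matrixElement A ψ f := by
  have h : 0 ≤ cfc f A := cfc_nonneg fun x _ => hf x
  have h2 := (ContinuousLinearMap.nonneg_iff_isPositive _).1 h
  exact h2.re_inner_nonneg_right ψ

theorem matrixElement_polynomial {E : Type*} [NormedAddCommGroup E] [InnerProductSpace ℂ E]
    [CompleteSpace E] (A : E →L[ℂ] E) (hA : IsSelfAdjoint A) (ψ : E) (p : Polynomial ℝ) :
    matrixElement A ψ (fun x => p.eval x)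
      = ∑ n ∈ Finset.range (p.natDegree + 1), p.coeff n * (inner ℂ ψ ((A ^ n) ψ)).re := by
  rw [matrixElement, cfc_polynomial p A hA, Polynomial.aeval_eq_sum_range, sum_apply, inner_sum,
    Complex.re_sum]
  refine Finset.sum_congr rfl fun n _ => ?_
  rw [smul_apply, inner_smul_right_eq_smul, Complex.real_smul, Complex.re_ofReal_mul]

/-- `Tr (π_o f(H_ω(lam)) π_o) = ⟨δ_o, f(H_ω(lam)) δ_o⟩`. -/
def localTrace {V : Type*} {G : SimpleGraph V} [G.LocallyFinite] {k : ℕ}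
    (hreg : G.IsRegularOfDegree k) (o : V) (lam : ℝ) (f : ℝ → ℝ) (ω : Config V) : ℝ :=
  matrixElement (hamiltonian hreg lam ω) (delta o) f

/-- The density of states functional
`n_lam(f) = 𝔼 { Tr (π_o f(H_ω(lam)) π_o) }`, the `ω_x` being i.i.d. with common law `μ`. -/
def dosFunctional {V : Type*} {G : SimpleGraph V} [G.LocallyFinite] {k : ℕ}
    (hreg : G.IsRegularOfDegree k) (o : V) (μ : Measure (Set.Icc (-1 : ℝ) 1))
    [IsProbabilityMeasure μ] (lam : ℝ) (f : ℝ → ℝ) : ℝ :=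
  ∫ ω, localTrace hreg o lam f ω ∂(Measure.infinitePi fun _ : V => μ)

theorem measurable_pow_apply {V : Type*} {G : SimpleGraph V} [G.LocallyFinite] {k : ℕ}
    (hreg : G.IsRegularOfDegree k) (o : V) (lam : ℝ) (n : ℕ) (x : V) :
    Measurable fun ω : Config V => ((hamiltonian hreg lam ω ^ n) (delta o) : Ell2 V) x := by
  induction n generalizing x with
  | zero => exact measurable_const
  | succ n ih =>
    have h0 : (fun ω : Config V => ((hamiltonian hreg lam ω ^ (n + 1)) (delta o) : Ell2 V) x)
        = fun ω : Config V =>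
          ∑ y ∈ G.neighborFinset x, ((hamiltonian hreg lam ω ^ n) (delta o) : Ell2 V) y
            + (lam : ℂ) * (((ω x : ℝ) : ℂ)
              * ((hamiltonian hreg lam ω ^ n) (delta o) : Ell2 V) x) := by
      funext ω
      rw [pow_succ', ← hamiltonian_apply hreg]
      rfl
    rw [h0]
    have h1 : Measurable fun ω : Config V => ((ω x : ℝ) : ℂ) :=
      Complex.measurable_ofReal.comp (measurable_subtype_coe.comp (measurable_pi_apply x))
    exact (Finset.measurable_sum _ fun y _ => ih y).add ((h1.mul (ih x)).const_mul _)

theorem measurable_localTrace {V : Type*} {G : SimpleGraph V} [G.LocallyFinite] {k : ℕ}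
    (hreg : G.IsRegularOfDegree k) (o : V) (lam : ℝ) {f : ℝ → ℝ} (hf : Continuous f) :
    Measurable (localTrace hreg o lam f) := by
  have hp : ∀ n : ℕ, ∃ p : Polynomial ℝ, ∀ x ∈ Set.Icc (-(k + |lam|)) (k + |lam|),
      |p.eval x - f x| < 1 / ((n : ℝ) + 1) := fun n =>
    exists_polynomial_near_of_continuousOn _ _ f hf.continuousOn _ (by positivity)
  choose p hp using hp
  refine measurable_of_tendsto_metrizable
    (f := fun n => localTrace hreg o lam fun x => (p n).eval x) (fun n => ?_) ?_
  · have h : (localTrace hreg o lam fun x => (p n).eval x) = fun ω : Config V =>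
        ∑ m ∈ Finset.range ((p n).natDegree + 1), (p n).coeff m
          * (((hamiltonian hreg lam ω ^ m) (delta o) : Ell2 V) o).re := by
      funext ω
      refine (matrixElement_polynomial _ (isSelfAdjoint_hamiltonian hreg lam ω) _ _).trans ?_
      refine Finset.sum_congr rfl fun m _ => ?_
      rw [← inner_delta_left o]
    rw [h]
    exact Finset.measurable_sum _ fun m _ =>
      (Complex.measurable_re.comp (measurable_pow_apply hreg o lam m o)).const_mul _
  · rw [tendsto_pi_nhds]
    intro ω
    rw [tendsto_iff_dist_tendsto_zero]
    refine squeeze_zero (fun _ => dist_nonneg) (fun n => ?_)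
      tendsto_one_div_add_atTop_nhds_zero_nat
    have h1 : localTrace hreg o lam (fun x => (p n).eval x) ω - localTrace hreg o lam f ω
        = localTrace hreg o lam (fun x => (p n).eval x + (-1) * f x) ω := by
      have h2 := matrixElement_add (hamiltonian hreg lam ω) (delta o) (p n).continuous
        (g := fun x => (-1) * f x) (continuous_const.mul hf)
      have h3 := matrixElement_const_mul (hamiltonian hreg lam ω) (delta o) (-1) hf
      simp only [localTrace]
      linarith
    rw [Real.dist_eq, h1]
    refine abs_matrixElement_le _ (norm_delta o) (norm_hamiltonian_le hreg lam ω)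
      (by positivity) fun x hx => ?_
    have h4 := (hp n x hx).le
    rwa [neg_one_mul, ← sub_eq_add_neg]

theorem integrable_localTrace {V : Type*} {G : SimpleGraph V} [G.LocallyFinite] {k : ℕ}
    (hreg : G.IsRegularOfDegree k) (o : V) (μ : Measure (Set.Icc (-1 : ℝ) 1))
    [IsProbabilityMeasure μ] (lam : ℝ) {f : ℝ → ℝ} (hf : Continuous f) :
    Integrable (localTrace hreg o lam f) (Measure.infinitePi fun _ : V => μ) := by
  obtain ⟨C, hC⟩ := (isCompact_Icc (a := -(k + |lam|)) (b := k + |lam|)).exists_bound_of_continuousOn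
    hf.continuousOn
  refine Integrable.of_bound (measurable_localTrace hreg o lam hf).aestronglyMeasurable |C|
    (Filter.Eventually.of_forall fun ω => ?_)
  exact abs_matrixElement_le _ (norm_delta o) (norm_hamiltonian_le hreg lam ω) (abs_nonneg _)
    fun x hx => (hC x hx).trans (le_abs_self C)

/-- The density of states functional as a positive linear functional on `C_c(ℝ)`. -/
def dosPositive {V : Type*} {G : SimpleGraph V} [G.LocallyFinite] {k : ℕ}
    (hreg : G.IsRegularOfDegree k) (o : V) (μ : Measure (Set.Icc (-1 : ℝ) 1))
    [IsProbabilityMeasure μ] (lam : ℝ) : CompactlySupportedContinuousMap ℝ ℝ →ₚ[ℝ] ℝ :=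
  PositiveLinearMap.mk₀
    { toFun := fun f => dosFunctional hreg o μ lam f
      map_add' := fun f g => by
        refine Eq.trans ?_ (integral_add (integrable_localTrace hreg o μ lam f.continuous)
          (integrable_localTrace hreg o μ lam g.continuous))
        exact integral_congr_ae (Filter.Eventually.of_forall fun ω =>
          matrixElement_add _ _ f.continuous g.continuous)
      map_smul' := fun c f => by
        refine Eq.trans ?_ (integral_const_mul c _)
        exact integral_congr_ae (Filter.Eventually.of_forall fun ω =>
          matrixElement_const_mul _ _ c f.continuous) }
    (fun f hf => integral_nonneg fun ω => matrixElement_nonneg _ _ fun x => hf x)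

/-- The density of states measure `n_lam`: the Borel measure on `ℝ` that represents the density of
states functional. -/
def dosMeasure {V : Type*} {G : SimpleGraph V} [G.LocallyFinite] {k : ℕ}
    (hreg : G.IsRegularOfDegree k) (o : V) (μ : Measure (Set.Icc (-1 : ℝ) 1))
    [IsProbabilityMeasure μ] (lam : ℝ) : Measure ℝ :=
  RealRMK.rieszMeasure (dosPositive hreg o μ lam)

theorem integral_dosMeasure {V : Type*} {G : SimpleGraph V} [G.LocallyFinite] {k : ℕ}
    (hreg : G.IsRegularOfDegree k) (o : V) (μ : Measure (Set.Icc (-1 : ℝ) 1))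
    [IsProbabilityMeasure μ] (lam : ℝ) (f : CompactlySupportedContinuousMap ℝ ℝ) :
    ∫ x, f x ∂(dosMeasure hreg o μ lam) = dosFunctional hreg o μ lam f :=
  RealRMK.integral_rieszMeasure _ f

/-- The integrated density of states `N_lam(E) = n_lam((-∞, E))`. -/
def ids {V : Type*} {G : SimpleGraph V} [G.LocallyFinite] {k : ℕ}
    (hreg : G.IsRegularOfDegree k) (o : V) (μ : Measure (Set.Icc (-1 : ℝ) 1))
    [IsProbabilityMeasure μ] (lam E : ℝ) : ℝ :=
  (dosMeasure hreg o μ lam).real (Set.Iio E)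

/-- `f` is Lipschitz on `S`. -/
def IsLip (S : Set ℝ) (f : ℝ → ℝ) : Prop := ∃ K, LipschitzOnWith K f S

/-- The norm `‖f‖_Lip = ‖f‖_∞ + sup_{x ≠ y} |f x - f y| / |x - y|` of a Lipschitz function on a
bounded set `S`; both suprema are taken over `S`. -/
def lipNorm (S : Set ℝ) (f : ℝ → ℝ) : ℝ :=
  sSup {t | ∃ x ∈ S, t = |f x|}
    + sSup {t | ∃ x ∈ S, ∃ y ∈ S, x ≠ y ∧ t = |f x - f y| / |x - y|}

/-- `ξ₀ = 2e / (1 + 2e)`. -/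
def xiZero : ℝ := 2 * Real.exp 1 / (1 + 2 * Real.exp 1)

/-- `λ_𝔹 = exp (-3 log k / ξ₀)`. -/
def lamB (k : ℕ) : ℝ := Real.exp (-3 * Real.log k / xiZero)

/-- The interval `[-2 √(k-1) - λ_𝔹, 2 √(k-1) + λ_𝔹]`. -/
def energyInterval (k : ℕ) : Set ℝ :=
  Set.Icc (-2 * √((k : ℝ) - 1) - lamB k) (2 * √((k : ℝ) - 1) + lamB k)

/-- The optimal constant `c_b` in the approximation by Bernstein polynomials. -/
def bernsteinConst : ℝ := (4306 + 837 * √6) / 5832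

/-- The constant in the bound on the density of states measure. -/
def gammaTilde (k : ℕ) : ℝ :=
  2 * (2 * (2 * √(k : ℝ) + lamB k) * bernsteinConst * √(Real.log k) + 1)

/-- The maximum over `E` of the density of states function
`ρ₀(E) = (k / 2π) √(4(k-1) - E²) / (k² - E²)`, `|E| ≤ 2 √(k-1)`, of the free Laplacian on the
Bethe lattice; the maximum is attained at `E² = 8(k-1) - k²` if `k ≤ 6` and at `E = 0` if
`k ≥ 7`. -/
def cB (k : ℕ) : ℝ :=
  if k ≤ 6 then (k : ℝ) / (4 * Real.pi * √((k : ℝ) ^ 2 - 4 * ((k : ℝ) - 1)))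
  else √(4 * ((k : ℝ) - 1)) / (2 * Real.pi * k)

/-- The constant in the bound on the integrated density of states. -/
def cTilde (k : ℕ) : ℝ := gammaTilde k + cB k

end BetheAnderson

end

noncomputable section

namespace BetheAnderson

/-! ### Geometry of the regular tree and the norm of its Laplacian -/

section Tree

variable {V : Type*} {G : SimpleGraph V}

/-! On the tree `‖Δ‖ ≤ 2√(k-1)`, so for `0 ≤ λ ≤ λ_𝔹` every `H_ω(λ)` has its spectrum in `I` and
only the values of `f` on `I` matter. Since `‖H_ω(λ) - Δ‖ ≤ λ` for every `ω`, part (i) is a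
deterministic perturbation bound, integrated over `ω`; nothing about `μ` enters.

A Lipschitz function need not be operator Lipschitz, so `f` is replaced by its Bernstein polynomial
of degree `n` (`norm_cfc_sub_cfc_le`). With Lipschitz constant `K` and bound `M` on an interval of
radius `R`, the replacement costs `R K / √n` for each operator, and the polynomial at the two
operators differs by at most `M 2^n n λ / (2R)`. Put `L = log (λ^(-ξ₀))` and take `n` to be the
integer part of `L / log k`. Then `λ k^n ≤ 1`, which beats the factor `n 2^n` because `k ≥ 3`, and
`1/√n` is of order `√(log k / L)` (`error_le`).

For (ii), the indicator of `(-∞, E)` is squeezed between two piecewise linear ramps of width `δ`.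
Part (i) compares each ramp at `λ` and at `0` with an error of order `1/(δ√L)`. The two ramps differ
under `n_0` by `O(δ)`, because the free density of states is bounded: the Poisson kernel of `Δ` at
`δ_o` is the imaginary part of a Green function, which is explicit on the tree (`exists_green`). The
choice `δ = L^(-1/4)` balances the errors.

The sharp constants are not needed. Cauchy–Schwarz gives the Bernstein estimate, and the factor 2 in
`gammaTilde`, with `c_b ≥ 1`, leaves room for the rest; of `cB` only the sign is used. -/

theorem eq_of_adj_of_dist_eq (hG : G.IsTree) {o x y z : V} (hy : G.Adj x y) (hz : G.Adj x z)
    (hdy : G.dist o x = G.dist o y + 1) (hdz : G.dist o x = G.dist o z + 1) : y = z := by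
  obtain ⟨p, -, hp⟩ := hG.connected.exists_path_of_dist o y
  obtain ⟨q, -, hq⟩ := hG.connected.exists_path_of_dist o z
  have hp' : (p.concat hy.symm).IsPath :=
    (p.concat hy.symm).isPath_of_length_eq_dist (by rw [SimpleGraph.Walk.length_concat, hp, hdy])
  have hq' : (q.concat hz.symm).IsPath :=
    (q.concat hz.symm).isPath_of_length_eq_dist (by rw [SimpleGraph.Walk.length_concat, hq, hdz])
  -- Both geodesics, prolonged by an edge to `x`, are shortest paths; a tree has only one path from
  -- `o` to `x`, so their penultimate vertices agree.
  have h := (hG.existsUnique_path o x).unique hp' hq'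
  have h2 := congrArg SimpleGraph.Walk.penultimate h
  simpa using h2

theorem exists_adj_dist_eq (hG : G.IsTree) {o x : V} (hx : x ≠ o) :
    ∃ y, G.Adj x y ∧ G.dist o x = G.dist o y + 1 := by
  obtain ⟨p, -, hp⟩ := hG.connected.exists_path_of_dist o x
  have hnil : ¬ p.Nil := SimpleGraph.Walk.not_nil_of_ne hx.symm
  refine ⟨p.penultimate, (p.adj_penultimate hnil).symm, ?_⟩
  rcases hG.dist_eq_dist_add_one_of_adj o (p.adj_penultimate hnil) with h | h
  · have h1 := SimpleGraph.dist_le p.dropLast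
    have h2 : p.dropLast.length + 1 = p.length := by
      simpa using p.length_dropLast_add_one hnil
    omega
  · exact h

/-- The sum over the neighbours of `x ≠ o` of a function of the distance to `o`: one neighbour is
closer to `o` than `x`, all the others are further away. -/
theorem sum_neighborFinset_dist [G.LocallyFinite] (hG : G.IsTree) {k : ℕ}
    (hreg : G.IsRegularOfDegree k) {M : Type*} [AddCommMonoid M] (F : ℕ → M) {o x : V}
    (hx : x ≠ o) :
    ∑ y ∈ G.neighborFinset x, F (G.dist o y)
      = F (G.dist o x - 1) + (k - 1) • F (G.dist o x + 1) := by
  classical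
  obtain ⟨p, hp, hd⟩ := exists_adj_dist_eq hG hx
  have hmem : p ∈ G.neighborFinset x := by simpa using hp
  rw [← Finset.add_sum_erase _ _ hmem]
  congr 1
  · rw [hd, Nat.add_sub_cancel]
  · rw [Finset.sum_congr rfl (g := fun _ => F (G.dist o x + 1)), Finset.sum_const,
      Finset.card_erase_of_mem hmem, G.card_neighborFinset_eq_degree, hreg x]
    intro y hy
    rw [Finset.mem_erase, SimpleGraph.mem_neighborFinset] at hy
    rcases hG.dist_eq_dist_add_one_of_adj o hy.2 with h | h
    · exact absurd (eq_of_adj_of_dist_eq hG hy.2 hp h hd) hy.1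
    · rw [h]

theorem sum_neighborFinset_dist_self [G.LocallyFinite] {k : ℕ}
    (hreg : G.IsRegularOfDegree k) {M : Type*} [AddCommMonoid M] (F : ℕ → M) (o : V) :
    ∑ y ∈ G.neighborFinset o, F (G.dist o y) = k • F 1 := by
  rw [Finset.sum_congr rfl (g := fun _ => F 1), Finset.sum_const,
    G.card_neighborFinset_eq_degree, hreg o]
  intro y hy
  rw [SimpleGraph.dist_eq_one_iff_adj.2 (by simpa using hy)]

/-- A positive supersolution for the Schur test. With `q = √(k-1)`, away from `o` the weight
`q^(-dist)` is an exact eigenfunction with eigenvalue `2q`; at `o` the claim is `k ≤ 2(k-1)`. -/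
theorem weight_sum_le [G.LocallyFinite] (hG : G.IsTree) {k : ℕ} (hk : 2 ≤ k)
    (hreg : G.IsRegularOfDegree k) (o x : V) :
    ∑ y ∈ G.neighborFinset x, ((√((k : ℝ) - 1))⁻¹) ^ G.dist o y
      ≤ 2 * √((k : ℝ) - 1) * ((√((k : ℝ) - 1))⁻¹) ^ G.dist o x := by
  have hk' : (2 : ℝ) ≤ k := by exact_mod_cast hk
  set q := √((k : ℝ) - 1) with hq
  have hq2 : q ^ 2 = k - 1 := Real.sq_sqrt (by linarith)
  have hq0 : 0 < q := Real.sqrt_pos.2 (by linarith)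
  by_cases hx : x = o
  · subst hx
    rw [sum_neighborFinset_dist_self hreg (fun n => q⁻¹ ^ n), SimpleGraph.dist_self, nsmul_eq_mul,
      pow_one, pow_zero, mul_one, mul_inv_le_iff₀ hq0]
    nlinarith
  · rw [sum_neighborFinset_dist hG hreg (fun n => q⁻¹ ^ n) hx, nsmul_eq_mul,
      Nat.cast_sub (by omega), Nat.cast_one, ← hq2]
    obtain ⟨n, hn⟩ : ∃ n, G.dist o x = n + 1 :=
      Nat.exists_eq_succ_of_ne_zero (hG.connected.pos_dist_of_ne (Ne.symm hx)).ne'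
    rw [hn, Nat.add_sub_cancel]
    have hqq : q * q⁻¹ = 1 := mul_inv_cancel₀ hq0.ne'
    apply le_of_eq
    calc q⁻¹ ^ n + q ^ 2 * q⁻¹ ^ (n + 1 + 1) = q⁻¹ ^ n * (1 + (q * q⁻¹) ^ 2) := by ring
      _ = 2 * (q * q⁻¹) * q⁻¹ ^ n := by rw [hqq]; ring
      _ = _ := by ring

/-- Schur test: Cauchy–Schwarz weighted by `w` at each `x`, then exchange of the sums and a second
use of the supersolution property. This improves the trivial bound `k` to the spectral radius. -/
theorem laplacian_sum_sq_le_of_isTree [G.LocallyFinite] (hG : G.IsTree) {k : ℕ} (hk : 2 ≤ k)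
    (hreg : G.IsRegularOfDegree k) (ψ : Ell2 V) (s : Finset V) :
    ∑ x ∈ s, ‖∑ y ∈ G.neighborFinset x, ψ y‖ ^ 2 ≤ (2 * √((k : ℝ) - 1) * ‖ψ‖) ^ 2 := by
  classical
  obtain ⟨o⟩ := hG.connected.nonempty
  have hk' : (2 : ℝ) ≤ k := by exact_mod_cast hk
  have hsum := weight_sum_le hG hk hreg o
  have hq0 : 0 < √((k : ℝ) - 1) := Real.sqrt_pos.2 (by linarith)
  set q := √((k : ℝ) - 1)
  set w : V → ℝ := fun x => q⁻¹ ^ G.dist o x with hw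
  have hw0 : ∀ x, 0 < w x := fun x => by positivity
  replace hsum : ∀ x, ∑ y ∈ G.neighborFinset x, w y ≤ 2 * q * w x := hsum
  have h1 : ∀ x ∈ s, ‖∑ y ∈ G.neighborFinset x, ψ y‖ ^ 2
      ≤ 2 * q * ∑ y ∈ G.neighborFinset x, w x * (‖ψ y‖ ^ 2 / w y) := by
    intro x _
    calc ‖∑ y ∈ G.neighborFinset x, ψ y‖ ^ 2
        ≤ (∑ y ∈ G.neighborFinset x, ‖ψ y‖) ^ 2 := by
          gcongr
          exact norm_sum_le _ _
      _ ≤ (∑ y ∈ G.neighborFinset x, w y) * ∑ y ∈ G.neighborFinset x, ‖ψ y‖ ^ 2 / w y :=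
          Finset.sum_sq_le_sum_mul_sum_of_sq_le_mul _ (fun y _ => (hw0 y).le)
            (fun y _ => div_nonneg (sq_nonneg _) (hw0 y).le)
            (fun y _ => by rw [mul_div_cancel₀ _ (hw0 y).ne'])
      _ ≤ (2 * q * w x) * ∑ y ∈ G.neighborFinset x, ‖ψ y‖ ^ 2 / w y := by
          gcongr
          exact hsum x
      _ = _ := by rw [mul_assoc, ← Finset.mul_sum]
  have h2 : ∑ x ∈ s, ∑ y ∈ G.neighborFinset x, w x * (‖ψ y‖ ^ 2 / w y)
      = ∑ y ∈ s.biUnion (fun x => G.neighborFinset x),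
          ∑ x ∈ s.filter (fun x => G.Adj y x), w x * (‖ψ y‖ ^ 2 / w y) := by
    apply Finset.sum_comm'
    intro x y
    simp only [SimpleGraph.mem_neighborFinset, Finset.mem_filter, Finset.mem_biUnion]
    constructor
    · rintro ⟨hx, hxy⟩
      exact ⟨⟨hx, hxy.symm⟩, x, hx, hxy⟩
    · rintro ⟨⟨hx, hxy⟩, -⟩
      exact ⟨hx, hxy.symm⟩
  have h3 : ∀ y, ∑ x ∈ s.filter (fun x => G.Adj y x), w x * (‖ψ y‖ ^ 2 / w y)
      ≤ 2 * q * ‖ψ y‖ ^ 2 := by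
    intro y
    rw [← Finset.sum_mul]
    have h4 : ∑ x ∈ s.filter (fun x => G.Adj y x), w x ≤ 2 * q * w y :=
      (Finset.sum_le_sum_of_subset_of_nonneg
        (fun x hx => by simpa using (Finset.mem_filter.1 hx).2) (fun x _ _ => (hw0 x).le)).trans
        (hsum y)
    calc _ ≤ 2 * q * w y * (‖ψ y‖ ^ 2 / w y) :=
          mul_le_mul_of_nonneg_right h4 (div_nonneg (sq_nonneg _) (hw0 y).le)
      _ = _ := by rw [mul_assoc, mul_div_cancel₀ _ (hw0 y).ne']
  calc ∑ x ∈ s, ‖∑ y ∈ G.neighborFinset x, ψ y‖ ^ 2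
      ≤ ∑ x ∈ s, 2 * q * ∑ y ∈ G.neighborFinset x, w x * (‖ψ y‖ ^ 2 / w y) :=
        Finset.sum_le_sum h1
    _ = 2 * q * ∑ y ∈ s.biUnion (fun x => G.neighborFinset x),
          ∑ x ∈ s.filter (fun x => G.Adj y x), w x * (‖ψ y‖ ^ 2 / w y) := by
        rw [← Finset.mul_sum, h2]
    _ ≤ 2 * q * ∑ y ∈ s.biUnion (fun x => G.neighborFinset x), 2 * q * ‖ψ y‖ ^ 2 := by
        gcongr with y hy
        exact h3 y
    _ ≤ 2 * q * (2 * q * ‖ψ‖ ^ 2) := by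
        rw [← Finset.mul_sum]
        gcongr
        exact sum_sq_le ψ _
    _ = _ := by ring

theorem norm_laplacian_le [G.LocallyFinite] (hG : G.IsTree) {k : ℕ} (hk : 2 ≤ k)
    (hreg : G.IsRegularOfDegree k) : ‖laplacian hreg‖ ≤ 2 * √((k : ℝ) - 1) :=
  ContinuousLinearMap.opNorm_le_bound _ (by positivity) fun ψ =>
    norm_le_of_sum_sq_le (by positivity) (laplacian_sum_sq_le_of_isTree hG hk hreg ψ)

/-- Each vertex of a sphere around `o` of positive radius loses its parent among its `k` neighbours,
so at most `k - 1` lie on the next sphere. -/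
theorem exists_sphere_card_le [G.LocallyFinite] (hG : G.IsTree) {k : ℕ}
    (hreg : G.IsRegularOfDegree k) (o : V) (n : ℕ) :
    ∃ T : Finset V, (∀ x, x ∈ T ↔ G.dist o x = n + 1) ∧ T.card ≤ k * (k - 1) ^ n := by
  classical
  induction n with
  | zero =>
    refine ⟨G.neighborFinset o, fun x => ?_, ?_⟩
    · simp
    · simp [hreg o]
  | succ n ih =>
    obtain ⟨T, hT, hc⟩ := ih
    refine ⟨T.biUnion fun x => (G.neighborFinset x).filter fun y => G.dist o y = n + 1 + 1,
      fun y => ?_, ?_⟩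
    · simp only [Finset.mem_biUnion, Finset.mem_filter, SimpleGraph.mem_neighborFinset]
      constructor
      · rintro ⟨x, -, -, h⟩
        exact h
      · intro h
        have hy : y ≠ o := by
          rintro rfl
          simp at h
        obtain ⟨x, hx, hd⟩ := exists_adj_dist_eq hG hy
        exact ⟨x, (hT x).2 (by omega), hx.symm, h⟩
    · refine (Finset.card_biUnion_le_card_mul _ _ (k - 1) fun x hx => ?_).trans ?_
      · have hd := (hT x).1 hx
        have hxo : x ≠ o := by
          rintro rfl
          simp at hd
        obtain ⟨p, hp, hdp⟩ := exists_adj_dist_eq hG hxo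
        have hmem : p ∈ G.neighborFinset x := by simpa using hp
        rw [← hreg x, ← G.card_neighborFinset_eq_degree, ← Finset.card_erase_of_mem hmem]
        refine Finset.card_le_card fun y hy => ?_
        rw [Finset.mem_filter] at hy
        refine Finset.mem_erase.2 ⟨?_, hy.1⟩
        rintro rfl
        omega
      · rw [pow_succ, ← mul_assoc]
        exact Nat.mul_le_mul_right _ hc

/-- Radial exponential functions with decay rate below `(k - 1)^(-1/2)` are square summable. -/
theorem memLp_pow_dist [G.LocallyFinite] (hG : G.IsTree) {k : ℕ} (hk : 1 ≤ k)
    (hreg : G.IsRegularOfDegree k) (o : V) {m : ℂ} (hm : ‖m‖ ^ 2 * ((k : ℝ) - 1) < 1) (c : ℂ) :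
    Memℓp (E := fun _ : V => ℂ) (fun x => c * m ^ G.dist o x) 2 := by
  classical
  choose T hT hc using exists_sphere_card_le hG hreg o
  have hk1 : (0 : ℝ) ≤ (k : ℝ) - 1 := by
    have : (1 : ℝ) ≤ k := by exact_mod_cast hk
    linarith
  set r := ‖m‖ ^ 2 * ((k : ℝ) - 1) with hr
  have hr0 : 0 ≤ r := by positivity
  refine memLp_of_sum_sq_le (C := ‖c‖ ^ 2 * (1 + k * ‖m‖ ^ 2 * (1 - r)⁻¹)) fun s => ?_
  have hfac : ∀ x, ‖c * m ^ G.dist o x‖ ^ 2 = ‖c‖ ^ 2 * (‖m‖ ^ 2) ^ G.dist o x := by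
    intro x
    rw [norm_mul, norm_pow, mul_pow, ← pow_mul, ← pow_mul, mul_comm 2]
  simp only [hfac, ← Finset.mul_sum]
  gcongr
  set N := s.sup (G.dist o) with hN
  have hsub : s ⊆ insert o ((Finset.range N).biUnion T) := by
    intro x hx
    rw [Finset.mem_insert, Finset.mem_biUnion]
    by_cases hxo : x = o
    · exact Or.inl hxo
    · right
      have h1 := hG.connected.pos_dist_of_ne (Ne.symm hxo)
      have h2 : G.dist o x ≤ N := Finset.le_sup (f := G.dist o) hx
      exact ⟨G.dist o x - 1, Finset.mem_range.2 (by omega), (hT _ _).2 (by omega)⟩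
  have ho : o ∉ (Finset.range N).biUnion T := by
    simp [hT]
  calc ∑ x ∈ s, (‖m‖ ^ 2) ^ G.dist o x
      ≤ ∑ x ∈ insert o ((Finset.range N).biUnion T), (‖m‖ ^ 2) ^ G.dist o x :=
        Finset.sum_le_sum_of_subset_of_nonneg hsub fun x _ _ => by positivity
    _ = 1 + ∑ x ∈ (Finset.range N).biUnion T, (‖m‖ ^ 2) ^ G.dist o x := by
        rw [Finset.sum_insert ho, SimpleGraph.dist_self, pow_zero]
    _ = 1 + ∑ n ∈ Finset.range N, ∑ x ∈ T n, (‖m‖ ^ 2) ^ G.dist o x := by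
        rw [Finset.sum_biUnion]
        intro i _ j _ hij
        rw [Function.onFun, Finset.disjoint_left]
        intro x hx hx'
        rw [hT] at hx hx'
        omega
    _ ≤ 1 + ∑ n ∈ Finset.range N, k * ‖m‖ ^ 2 * r ^ n := by
        gcongr with n hn
        rw [Finset.sum_congr rfl (g := fun _ => (‖m‖ ^ 2) ^ (n + 1))
          fun x hx => by rw [(hT n x).1 hx], Finset.sum_const, nsmul_eq_mul]
        have h1 : ((T n).card : ℝ) ≤ k * ((k : ℝ) - 1) ^ n := by
          have := hc n
          rw [← Nat.cast_one, ← Nat.cast_sub hk]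
          exact_mod_cast this
        calc _ ≤ (k * ((k : ℝ) - 1) ^ n) * (‖m‖ ^ 2) ^ (n + 1) := by gcongr
          _ = _ := by rw [hr, mul_pow]; ring
    _ ≤ 1 + k * ‖m‖ ^ 2 * (1 - r)⁻¹ := by
        rw [← Finset.mul_sum]
        gcongr
        rw [← tsum_geometric_of_lt_one hr0 hm]
        exact (summable_geometric_of_lt_one hr0 hm).sum_le_tsum _ fun n _ => by positivity

end Tree

/-! ### Bernstein approximation and perturbation of the functional calculus -/

section Bernstein

/-- Telescoping: each of the `i + j` factors is exchanged once, the others being contractions. No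
commutation between `a` and `b` is required. -/
theorem norm_pow_mul_sub_le {A : Type*} [NormedRing A] [NormOneClass A] {a b c d : A} (ha : ‖a‖ ≤ 1)
    (hb : ‖b‖ ≤ 1) (hc : ‖c‖ ≤ 1) (hd : ‖d‖ ≤ 1) {ε : ℝ} (h₁ : ‖a - b‖ ≤ ε) (h₂ : ‖c - d‖ ≤ ε)
    (i j : ℕ) : ‖a ^ i * c ^ j - b ^ i * d ^ j‖ ≤ ((i + j : ℕ) : ℝ) * ε := by
  have hpow : ∀ {a : A}, ‖a‖ ≤ 1 → ∀ i, ‖a ^ i‖ ≤ 1 := fun {a} ha i =>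
    (norm_pow_le a i).trans (pow_le_one₀ (norm_nonneg _) ha)
  have hmul : ∀ {x y : A} {δ : ℝ}, ‖x‖ ≤ δ → ‖y‖ ≤ 1 → ‖x * y‖ ≤ δ := fun {x y δ} hx hy =>
    (norm_mul_le x y).trans <| by nlinarith [norm_nonneg x, norm_nonneg y]
  have hmul' : ∀ {x y : A} {δ : ℝ}, ‖x‖ ≤ 1 → ‖y‖ ≤ δ → ‖x * y‖ ≤ δ := fun {x y δ} hx hy =>
    (norm_mul_le x y).trans <| by nlinarith [norm_nonneg x, norm_nonneg y]
  have key : ∀ {a b : A}, ‖a‖ ≤ 1 → ‖b‖ ≤ 1 → ‖a - b‖ ≤ ε → ∀ i : ℕ,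
      ‖a ^ i - b ^ i‖ ≤ i * ε := by
    intro a b ha hb h i
    induction i with
    | zero => simp
    | succ i ih =>
      have : a ^ (i + 1) - b ^ (i + 1) = (a ^ i - b ^ i) * a + b ^ i * (a - b) := by
        rw [pow_succ, pow_succ]
        noncomm_ring
      rw [this]
      refine (norm_add_le _ _).trans ((add_le_add (hmul ih ha) (hmul' (hpow hb i) h)).trans ?_)
      push_cast
      linarith
  have : a ^ i * c ^ j - b ^ i * d ^ j = (a ^ i - b ^ i) * c ^ j + b ^ i * (c ^ j - d ^ j) := by
    noncomm_ring
  rw [this]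
  refine (norm_add_le _ _).trans ((add_le_add (hmul (key ha hb h₁ i) (hpow hc j))
    (hmul' (hpow hb i) (key hc hd h₂ j))).trans ?_)
  push_cast
  linarith

/-- Keeping the Bernstein basis in product form, with `S` and `1 - S` both contractions, avoids the
large coefficients of its expansion in monomials. -/
theorem norm_aeval_bernsteinPolynomial_sub_le {A : Type*} [NormedRing A] [NormOneClass A]
    [NormedAlgebra ℝ A] {S T : A} (hS : ‖S‖ ≤ 1) (hT : ‖T‖ ≤ 1) (hS' : ‖1 - S‖ ≤ 1)
    (hT' : ‖1 - T‖ ≤ 1) {n j : ℕ} (hj : j ≤ n) :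
    ‖Polynomial.aeval S (bernsteinPolynomial ℝ n j) - Polynomial.aeval T (bernsteinPolynomial ℝ n j)‖
      ≤ n.choose j * (n * ‖S - T‖) := by
  have h : ∀ S : A, Polynomial.aeval S (bernsteinPolynomial ℝ n j)
      = (n.choose j : ℝ) • (S ^ j * (1 - S) ^ (n - j)) := by
    intro S
    simp [bernsteinPolynomial, mul_assoc, Nat.cast_smul_eq_nsmul]
  rw [h, h, ← smul_sub, norm_smul, Real.norm_natCast]
  gcongr
  have := norm_pow_mul_sub_le hS hT hS' hT' (ε := ‖S - T‖) le_rfl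
    (by rw [sub_sub_sub_cancel_left, norm_sub_rev]) j (n - j)
  rwa [Nat.add_sub_cancel' hj] at this

/-- Bernstein approximation of a Lipschitz function on `[0, 1]`. -/
theorem abs_sub_bernstein_sum_le {g : ℝ → ℝ} {K : ℝ}
    (hg : ∀ x ∈ Set.Icc (0 : ℝ) 1, ∀ y ∈ Set.Icc (0 : ℝ) 1, |g x - g y| ≤ K * |x - y|) {n : ℕ}
    (hn : n ≠ 0) {x : ℝ} (hx : x ∈ Set.Icc (0 : ℝ) 1) :
    |g x - ∑ j : Fin (n + 1), g (j / n) * (bernsteinPolynomial ℝ n j).eval x| ≤ K / (2 * √n) := by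
  have hn0 : (0 : ℝ) < n := by positivity
  have hK : 0 ≤ K := by
    have := hg 0 (by simp) 1 (by simp)
    have h2 := abs_nonneg (g 0 - g 1)
    norm_num at this
    linarith
  set b : Fin (n + 1) → ℝ := fun j => (bernsteinPolynomial ℝ n j).eval x with hb
  have hb0 : ∀ j, 0 ≤ b j := fun j => bernstein_nonneg (n := n) (ν := j) (x := ⟨x, hx⟩)
  have hb1 : ∑ j, b j = 1 := bernstein.probability n ⟨x, hx⟩
  have hvar : ∑ j : Fin (n + 1), (x - j / n) ^ 2 * b j = x * (1 - x) / n :=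
    bernstein.variance hn ⟨x, hx⟩
  have hmem : ∀ j : Fin (n + 1), (j / n : ℝ) ∈ Set.Icc (0 : ℝ) 1 := fun j =>
    (bernstein.z j).2
  -- The mean absolute deviation of the binomial law is at most its standard deviation, and `x(1-x)
  -- ≤ 1/4`.
  have hfirst : ∑ j : Fin (n + 1), |x - j / n| * b j ≤ 1 / (2 * √n) := by
    apply le_of_sq_le_sq _ (by positivity)
    calc (∑ j : Fin (n + 1), |x - j / n| * b j) ^ 2
        ≤ (∑ j, b j) * ∑ j : Fin (n + 1), (x - j / n) ^ 2 * b j :=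
          Finset.sum_sq_le_sum_mul_sum_of_sq_le_mul _ (fun j _ => hb0 j)
            (fun j _ => mul_nonneg (sq_nonneg _) (hb0 j))
            (fun j _ => le_of_eq (by rw [mul_pow, sq_abs]; ring))
      _ = x * (1 - x) / n := by rw [hb1, hvar, one_mul]
      _ ≤ (1 / 4) / n := by
          gcongr
          nlinarith [sq_nonneg (x - 1 / 2)]
      _ = (1 / (2 * √n)) ^ 2 := by
          rw [div_pow, mul_pow, Real.sq_sqrt hn0.le]
          field_simp
          norm_num
  calc |g x - ∑ j : Fin (n + 1), g (j / n) * b j|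
      = |∑ j : Fin (n + 1), (g x - g (j / n)) * b j| := by
        simp only [sub_mul, Finset.sum_sub_distrib, ← Finset.mul_sum, hb1, mul_one]
    _ ≤ ∑ j : Fin (n + 1), |(g x - g (j / n)) * b j| := Finset.abs_sum_le_sum_abs _ _
    _ ≤ ∑ j : Fin (n + 1), K * (|x - j / n| * b j) := by
        refine Finset.sum_le_sum fun j _ => ?_
        rw [abs_mul, abs_of_nonneg (hb0 j), ← mul_assoc]
        exact mul_le_mul_of_nonneg_right (hg x hx _ (hmem j)) (hb0 j)
    _ ≤ K * (1 / (2 * √n)) := by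
        rw [← Finset.mul_sum]
        gcongr
    _ = _ := by ring

variable {E : Type*} [NormedAddCommGroup E] [InnerProductSpace ℂ E] [CompleteSpace E]

/-- Two bounded self-adjoint operators that are close have close images under the functional
calculus of a Lipschitz function. -/
theorem norm_cfc_sub_cfc_le [Nontrivial E] {A B : E →L[ℂ] E} (hA : IsSelfAdjoint A)
    (hB : IsSelfAdjoint B)
    {R K M : ℝ} (hR : 0 < R) (hAR : ‖A‖ ≤ R) (hBR : ‖B‖ ≤ R) {f : ℝ → ℝ}
    (hf : ∀ x ∈ Set.Icc (-R) R, ∀ y ∈ Set.Icc (-R) R, |f x - f y| ≤ K * |x - y|)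
    (hM : ∀ x ∈ Set.Icc (-R) R, |f x| ≤ M) {n : ℕ} (hn : n ≠ 0) :
    ‖cfc f A - cfc f B‖ ≤ 2 * R * K / √n + M * (2 ^ n * (n * (‖A - B‖ / (2 * R)))) := by
  have hM0 : 0 ≤ M := (abs_nonneg _).trans (hM 0 (by constructor <;> linarith))
  have hK : 0 ≤ K := by
    have := (abs_nonneg _).trans (hf R (by constructor <;> linarith) (-R) (by constructor <;> linarith))
    exact nonneg_of_mul_nonneg_left this (by rw [abs_pos]; linarith)
  -- The affine map from `[-R, R]` onto `[0, 1]`; `v` is its inverse. Being a polynomial, `U` can be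
  -- evaluated at operators.
  set U : Polynomial ℝ := Polynomial.C (2 * R)⁻¹ * (Polynomial.X + Polynomial.C R) with hU
  have hUeval : ∀ x, U.eval x = (2 * R)⁻¹ * (x + R) := fun x => by simp [hU]
  have hUmem : ∀ x ∈ Set.Icc (-R) R, U.eval x ∈ Set.Icc (0 : ℝ) 1 := by
    intro x hx
    rw [hUeval, inv_mul_eq_div]
    exact ⟨div_nonneg (by linarith [hx.1]) (by linarith),
      (div_le_one (by linarith)).2 (by linarith [hx.2])⟩
  set v : ℝ → ℝ := fun u => 2 * R * u - R with hv
  have hvmem : ∀ u ∈ Set.Icc (0 : ℝ) 1, v u ∈ Set.Icc (-R) R := by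
    intro u hu
    constructor <;> simp only [hv] <;> nlinarith [hu.1, hu.2]
  have hvU : ∀ x, v (U.eval x) = x := fun x => by
    rw [hUeval, hv]
    field_simp
    ring
  set P : Polynomial ℝ := ∑ j : Fin (n + 1),
    Polynomial.C (f (v (j / n))) * (bernsteinPolynomial ℝ n j).comp U with hP
  have hPf : ∀ x ∈ Set.Icc (-R) R, |f x - P.eval x| ≤ R * K / √n := by
    intro x hx
    have hPx : P.eval x
        = ∑ j : Fin (n + 1), f (v (j / n)) * (bernsteinPolynomial ℝ n j).eval (U.eval x) := by
      rw [hP, Polynomial.eval_finsetSum]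
      simp
    have h := abs_sub_bernstein_sum_le (g := fun u => f (v u)) (K := 2 * R * K) (fun u hu w hw => by
      refine (hf _ (hvmem u hu) _ (hvmem w hw)).trans (le_of_eq ?_)
      have : v u - v w = 2 * R * (u - w) := by simp only [hv]; ring
      rw [this, abs_mul, abs_of_pos (by linarith : (0 : ℝ) < 2 * R)]
      ring) hn (hUmem x hx)
    simp only [hvU] at h
    rw [hPx]
    refine h.trans (le_of_eq ?_)
    rw [mul_assoc, mul_div_mul_left _ _ two_ne_zero]
  have hcont : ContinuousOn f (Set.Icc (-R) R) := by
    have : LipschitzOnWith K.toNNReal f (Set.Icc (-R) R) :=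
      LipschitzOnWith.of_dist_le_mul fun x hx y hy => by
        rw [Real.coe_toNNReal _ hK]
        exact hf x hx y hy
    exact this.continuousOn
  have happrox : ∀ {A : E →L[ℂ] E}, IsSelfAdjoint A → ‖A‖ ≤ R →
      ‖cfc f A - Polynomial.aeval A P‖ ≤ R * K / √n := by
    intro A hA hAR
    have hsp := spectrum_subset A hAR
    rw [← cfc_polynomial P A hA, ← cfc_sub f _ A (hcont.mono hsp) P.continuous.continuousOn]
    exact norm_cfc_le (by positivity) fun x hx => hPf x (hsp hx)
  have hT : ∀ {A : E →L[ℂ] E}, IsSelfAdjoint A → ‖A‖ ≤ R →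
      ‖Polynomial.aeval A U‖ ≤ 1 ∧ ‖1 - Polynomial.aeval A U‖ ≤ 1 := by
    intro A hA hAR
    have hsp := spectrum_subset A hAR
    have h1 : 1 - Polynomial.aeval A U = Polynomial.aeval A (1 - U) := by simp
    rw [h1, ← cfc_polynomial U A hA, ← cfc_polynomial (1 - U) A hA]
    refine ⟨norm_cfc_le zero_le_one fun x hx => ?_, norm_cfc_le zero_le_one fun x hx => ?_⟩
    · have := hUmem x (hsp hx)
      rw [Real.norm_eq_abs, abs_le]
      constructor <;> linarith [this.1, this.2]
    · have := hUmem x (hsp hx)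
      rw [Real.norm_eq_abs, abs_le, Polynomial.eval_sub, Polynomial.eval_one]
      constructor <;> linarith [this.1, this.2]
  have hTsub : ‖Polynomial.aeval A U - Polynomial.aeval B U‖ = ‖A - B‖ / (2 * R) := by
    have : Polynomial.aeval A U - Polynomial.aeval B U = (2 * R)⁻¹ • (A - B) := by
      simp only [hU, map_mul, Polynomial.aeval_C, map_add, Polynomial.aeval_X,
        ← Algebra.smul_def, ← smul_sub, add_sub_add_right_eq_sub]
    rw [this, norm_smul, norm_inv, Real.norm_of_nonneg (by linarith), inv_mul_eq_div]
  have hpoly : ‖Polynomial.aeval A P - Polynomial.aeval B P‖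
      ≤ M * (2 ^ n * (n * (‖A - B‖ / (2 * R)))) := by
    have h : ∀ A : E →L[ℂ] E, Polynomial.aeval A P = ∑ j : Fin (n + 1),
        f (v (j / n)) • Polynomial.aeval (Polynomial.aeval A U) (bernsteinPolynomial ℝ n j) := by
      intro A
      rw [hP, map_sum]
      simp only [map_mul, Polynomial.aeval_C, Polynomial.aeval_comp, ← Algebra.smul_def]
    rw [h, h, ← Finset.sum_sub_distrib]
    calc _ ≤ ∑ j : Fin (n + 1), M * ((n.choose j : ℝ) * (n * (‖A - B‖ / (2 * R)))) := by
          refine norm_sum_le_of_le _ fun j _ => ?_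
          rw [← smul_sub, norm_smul, ← hTsub]
          gcongr
          · exact hM _ (hvmem _ (bernstein.z j).2)
          · exact norm_aeval_bernsteinPolynomial_sub_le (hT hA hAR).1 (hT hB hBR).1
              (hT hA hAR).2 (hT hB hBR).2 (Nat.lt_succ_iff.1 j.2)
      _ = _ := by
          rw [← Finset.mul_sum, ← Finset.sum_mul,
            Fin.sum_univ_eq_sum_range (fun j => (n.choose j : ℝ))]
          congr 2
          exact_mod_cast Nat.sum_range_choose n
  calc ‖cfc f A - cfc f B‖
      = ‖(cfc f A - Polynomial.aeval A P) + (Polynomial.aeval A P - Polynomial.aeval B P)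
          - (cfc f B - Polynomial.aeval B P)‖ := by congr 1; abel
    _ ≤ R * K / √n + M * (2 ^ n * (n * (‖A - B‖ / (2 * R)))) + R * K / √n :=
        (norm_sub_le _ _).trans (add_le_add ((norm_add_le _ _).trans
          (add_le_add (happrox hA hAR) hpoly)) (happrox hB hBR))
    _ = _ := by ring

theorem abs_matrixElement_sub_le (A B : E →L[ℂ] E) {ψ : E} (hψ : ‖ψ‖ = 1) (f : ℝ → ℝ) :
    |matrixElement A ψ f - matrixElement B ψ f| ≤ ‖cfc f A - cfc f B‖ := by
  have : matrixElement A ψ f - matrixElement B ψ f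
      = (inner ℂ ψ ((cfc f A - cfc f B) ψ)).re := by
    rw [sub_apply, inner_sub_right, Complex.sub_re]
    rfl
  rw [this]
  refine (Complex.abs_re_le_norm _).trans ((norm_inner_le_norm _ _).trans ?_)
  rw [hψ, one_mul]
  simpa [hψ] using (cfc f A - cfc f B).le_opNorm ψ

end Bernstein

/-! ### Green function and boundedness of the free density of states -/

section Density

/-- The Poisson kernel of width `η` at `E`, up to the factor `1 / π`. -/
def poissonKernel (E η x : ℝ) : ℝ := η / ((x - E) ^ 2 + η ^ 2)

theorem continuous_poissonKernel {E η : ℝ} (hη : 0 < η) : Continuous (poissonKernel E η) :=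
  continuous_const.div (by fun_prop) fun x => by positivity

/-- With `φ = (A - z)ψ`, the Poisson kernel of `A` is `η (A - z̄)⁻¹ (A - z)⁻¹`, so both sides equal
`η ‖ψ‖²`. Stated through `ψ`, this needs only a solution of `(A - z)ψ = φ` and no resolvent. -/
theorem matrixElement_poissonKernel {H : Type*} [NormedAddCommGroup H] [InnerProductSpace ℂ H]
    [CompleteSpace H] {A : H →L[ℂ] H} (hA : IsSelfAdjoint A) {E η : ℝ} (hη : 0 < η) (ψ : H) :
    matrixElement A (A ψ - (E + η * Complex.I : ℂ) • ψ) (poissonKernel E η)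
      = (inner ℂ (A ψ - (E + η * Complex.I : ℂ) • ψ) ψ).im := by
  set z : ℂ := E + η * Complex.I with hz
  set P := cfc (poissonKernel E η) A with hP
  have hsymm : ∀ x y, inner ℂ (A x) y = inner ℂ x (A y) := fun x y => hA.isSymmetric x y
  have hcomm : ∀ x, A (P x) = P (A x) := by
    intro x
    have h := (cfc_commute_cfc (poissonKernel E η) id A).eq
    rw [cfc_id ℝ A] at h
    exact (congrArg (fun T : H →L[ℂ] H => T x) h).symm
  set Q : Polynomial ℝ := Polynomial.X ^ 2 - Polynomial.C (2 * E) * Polynomial.X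
    + Polynomial.C (E ^ 2 + η ^ 2) with hQ
  have hPQ : P * Polynomial.aeval A Q = algebraMap ℝ (H →L[ℂ] H) η := by
    rw [← cfc_polynomial Q A hA, hP, ← cfc_mul _ _ A (continuous_poissonKernel hη).continuousOn
      Q.continuous.continuousOn, ← cfc_const η A hA]
    congr 1
    funext x
    have hx : Q.eval x = (x - E) ^ 2 + η ^ 2 := by
      simp [hQ]
      ring
    rw [hx, poissonKernel]
    exact div_mul_cancel₀ _ (by positivity)
  have hPψ : P (A (A ψ) - ((2 * E : ℝ) : ℂ) • A ψ + ((E ^ 2 + η ^ 2 : ℝ) : ℂ) • ψ)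
      = (η : ℂ) • ψ := by
    have h := congrArg (fun T : H →L[ℂ] H => T ψ) hPQ
    have hQψ : Polynomial.aeval A Q ψ
        = A (A ψ) - ((2 * E : ℝ) : ℂ) • A ψ + ((E ^ 2 + η ^ 2 : ℝ) : ℂ) • ψ := by
      rw [hQ, map_add, map_sub, map_mul, map_pow, Polynomial.aeval_X, Polynomial.aeval_C,
        Polynomial.aeval_C, ← Algebra.smul_def, Algebra.algebraMap_eq_smul_one]
      rfl
    rw [← hQψ]
    exact h.trans (by rw [Algebra.algebraMap_eq_smul_one]; rfl)
  have hin : inner ℂ (A ψ - z • ψ) (P (A ψ - z • ψ)) = (η : ℂ) * (‖ψ‖ : ℂ) ^ 2 := by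
    have h1 : inner ℂ (A ψ - z • ψ) (P (A ψ - z • ψ))
        = inner ℂ ψ (A (P (A ψ - z • ψ)) - (starRingEnd ℂ z) • P (A ψ - z • ψ)) := by
      rw [inner_sub_left, inner_sub_right, hsymm, inner_smul_left, inner_smul_right]
    have h2 : A (P (A ψ - z • ψ)) - (starRingEnd ℂ z) • P (A ψ - z • ψ)
        = P (A (A ψ) - ((2 * E : ℝ) : ℂ) • A ψ + ((E ^ 2 + η ^ 2 : ℝ) : ℂ) • ψ) := by
      rw [hcomm, ← map_smul, ← map_sub]
      congr 1
      have hc : starRingEnd ℂ z = E - η * Complex.I := by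
        simp [hz, sub_eq_add_neg]
      have hI := Complex.I_sq
      have e1 : ((2 * E : ℝ) : ℂ) = z + starRingEnd ℂ z := by
        rw [hc, hz]
        push_cast
        ring
      have e2 : ((E ^ 2 + η ^ 2 : ℝ) : ℂ) = starRingEnd ℂ z * z := by
        rw [hc, hz]
        push_cast
        linear_combination ((η : ℂ) ^ 2) * hI
      rw [e1, e2, map_sub, map_smul]
      module
    rw [h1, h2, hPψ, inner_smul_right, inner_self_eq_norm_sq_to_K]
    rfl
  have him : (inner ℂ (A ψ - z • ψ) ψ).im = η * ‖ψ‖ ^ 2 := by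
    rw [inner_sub_left, inner_smul_left, inner_self_eq_norm_sq_to_K]
    have h1 : (inner ℂ (A ψ) ψ).im = 0 := hA.isSymmetric.im_inner_apply_self ψ
    rw [Complex.sub_im, h1]
    simp [hz, ← Complex.ofReal_pow]
  rw [him, matrixElement, ← hP, hin, ← Complex.ofReal_pow, ← Complex.ofReal_mul,
    Complex.ofReal_re]

/-- The roots have product `1/q`. If neither were inside the disc of radius `q^(-1/2)`, both would
be on its boundary and hence conjugate, which would make their sum `z/q` real. -/
theorem exists_quadratic_root {q : ℝ} (hq : 0 < q) {z : ℂ} (hz : z.im ≠ 0) :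
    ∃ m : ℂ, (q : ℂ) * m ^ 2 - z * m + 1 = 0 ∧ ‖m‖ ^ 2 * q < 1 := by
  have hqc : (q : ℂ) ≠ 0 := by exact_mod_cast hq.ne'
  obtain ⟨s, hs⟩ := IsAlgClosed.exists_eq_mul_self (z ^ 2 - 4 * q)
  set m₁ := (z + s) / (2 * q) with hm₁
  set m₂ := (z - s) / (2 * q) with hm₂
  have h₁ : (q : ℂ) * m₁ ^ 2 - z * m₁ + 1 = 0 := by
    rw [hm₁]
    field_simp
    linear_combination -hs
  have h₂ : (q : ℂ) * m₂ ^ 2 - z * m₂ + 1 = 0 := by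
    rw [hm₂]
    field_simp
    linear_combination -hs
  by_contra! hcon
  have hc₁ := hcon _ h₁
  have hc₂ := hcon _ h₂
  have hprod : m₁ * m₂ * q = 1 := by
    rw [hm₁, hm₂]
    field_simp
    linear_combination hs
  have hsum : z = q * (m₁ + m₂) := by
    rw [hm₁, hm₂]
    field_simp
    ring
  have hn : (‖m₁‖ ^ 2 * q) * (‖m₂‖ ^ 2 * q) = 1 := by
    have h := congrArg norm hprod
    rw [norm_mul, norm_mul, Complex.norm_real, Real.norm_of_nonneg hq.le, norm_one] at h
    calc _ = (‖m₁‖ * ‖m₂‖ * q) ^ 2 := by ring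
      _ = 1 := by rw [h, one_pow]
  have hn1 : ‖m₁‖ ^ 2 * q = 1 := by nlinarith
  have hconj : m₂ = starRingEnd ℂ m₁ := by
    have h1 : m₁ * starRingEnd ℂ m₁ * q = 1 := by
      rw [Complex.mul_conj, Complex.normSq_eq_norm_sq, ← Complex.ofReal_mul, hn1,
        Complex.ofReal_one]
    have hm0 : m₁ ≠ 0 := by
      rintro h
      rw [h] at hprod
      simp at hprod
    exact mul_left_cancel₀ hm0 (mul_right_cancel₀ hqc (hprod.trans h1.symm))
  apply hz
  rw [hsum, hconj, Complex.add_conj]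
  simp

/-- The Green function of the `k`-regular tree with `k ≥ 3`, and a bound on its diagonal part. -/
theorem exists_green {V : Type*} {G : SimpleGraph V} [G.LocallyFinite] (hG : G.IsTree) {k : ℕ}
    (hk : 3 ≤ k) (hreg : G.IsRegularOfDegree k) (o : V) {z : ℂ} (hz : z.im ≠ 0) :
    ∃ ψ : Ell2 V, laplacian hreg ψ - z • ψ = delta o ∧ ‖ψ o‖ ≤ 3 / 2 := by
  classical
  have hk' : (3 : ℝ) ≤ k := by exact_mod_cast hk
  obtain ⟨m, hm, hlt⟩ := exists_quadratic_root (q := (k : ℝ) - 1) (by linarith) hz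
  have hm2 : ‖m‖ ^ 2 ≤ 1 / 2 := by nlinarith [sq_nonneg ‖m‖]
  have hm0 : m ≠ 0 := by
    rintro rfl
    simp at hm
  have hnorm : 1 / 2 ≤ ‖m ^ 2 - 1‖ := by
    have := norm_sub_norm_le 1 (m ^ 2)
    rw [norm_one, norm_pow, norm_sub_rev] at this
    linarith
  have hm1 : m ^ 2 - 1 ≠ 0 := fun h => by
    rw [h, norm_zero] at hnorm
    norm_num at hnorm
  -- The equation at `o` reads `c (k m - z) = 1`, and the quadratic for `m` gives `k m - z = m -
  -- 1/m`.
  set c := m / (m ^ 2 - 1) with hc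
  push_cast at hm
  refine ⟨⟨fun x => c * m ^ G.dist o x, memLp_pow_dist hG (by omega) hreg o hlt c⟩, ?_, ?_⟩
  · ext x
    rw [lp.coeFn_sub, Pi.sub_apply, lp.coeFn_smul, Pi.smul_apply, laplacian_apply, delta_apply,
      smul_eq_mul]
    change ∑ y ∈ G.neighborFinset x, c * m ^ G.dist o y - z * (c * m ^ G.dist o x) = _
    by_cases hx : x = o
    · subst hx
      rw [sum_neighborFinset_dist_self hreg (fun n => c * m ^ n), if_pos rfl,
        SimpleGraph.dist_self, nsmul_eq_mul, hc]
      field_simp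
      linear_combination hm
    · rw [sum_neighborFinset_dist hG hreg (fun n => c * m ^ n) hx, if_neg hx]
      obtain ⟨n, hn⟩ : ∃ n, G.dist o x = n + 1 :=
        Nat.exists_eq_succ_of_ne_zero (hG.connected.pos_dist_of_ne (Ne.symm hx)).ne'
      rw [hn, Nat.add_sub_cancel, nsmul_eq_mul, Nat.cast_sub (by omega), Nat.cast_one]
      linear_combination c * m ^ n * hm
  · change ‖c * m ^ G.dist o o‖ ≤ 3 / 2
    rw [SimpleGraph.dist_self, pow_zero, mul_one, hc, norm_div,
      div_le_iff₀ (lt_of_lt_of_le (by norm_num) hnorm)]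
    nlinarith [norm_nonneg m]

/-- The density of the spectral measure of the free Laplacian at `δ_o` is bounded. -/
theorem matrixElement_laplacian_poissonKernel_le {V : Type*} {G : SimpleGraph V} [G.LocallyFinite]
    (hG : G.IsTree) {k : ℕ} (hk : 3 ≤ k) (hreg : G.IsRegularOfDegree k) (o : V) (E : ℝ) {η : ℝ}
    (hη : 0 < η) (hsa : IsSelfAdjoint (laplacian hreg)) :
    matrixElement (laplacian hreg) (delta o) (poissonKernel E η) ≤ 3 / 2 := by
  obtain ⟨ψ, hψ, hb⟩ := exists_green hG hk hreg o (z := E + η * Complex.I) (by simp [hη.ne'])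
  have h := matrixElement_poissonKernel hsa hη (E := E) ψ
  rw [hψ, inner_delta_left] at h
  rw [h]
  exact (le_abs_self _).trans ((Complex.abs_im_le_norm _).trans hb)

end Density

/-! ### Choice of the degree and numerical estimates -/

section Numerics

theorem xiZero_pos : 0 < xiZero := by
  unfold xiZero
  positivity

theorem xiZero_le_one : xiZero ≤ 1 := by
  unfold xiZero
  rw [div_le_one (by positivity)]
  linarith

theorem lamB_pos (k : ℕ) : 0 < lamB k := Real.exp_pos _

/-- The sequence decreases from `n = 3` on, since `4(n+1)(n+2) ≤ 9n²` there (`80 ≤ 81` at `n = 3`).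
-/
theorem sq_mul_succ_mul_pow_le {n : ℕ} (hn : 3 ≤ n) :
    (n : ℝ) ^ 2 * (n + 1) * (4 / 9) ^ n ≤ 4 := by
  induction n, hn using Nat.le_induction with
  | base => norm_num
  | succ n hn ih =>
    have hn' : (3 : ℝ) ≤ n := by exact_mod_cast hn
    refine le_trans ?_ ih
    rw [pow_succ (4 / 9 : ℝ), ← mul_assoc, mul_right_comm]
    refine mul_le_mul_of_nonneg_right ?_ (by positivity)
    push_cast
    nlinarith [mul_nonneg (sub_nonneg.2 hn') (sub_nonneg.2 hn')]

theorem log_rpow_neg_xiZero {lam : ℝ} (hlam : 0 < lam) :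
    Real.log (lam ^ (-xiZero)) = -xiZero * Real.log lam := Real.log_rpow hlam _

theorem three_mul_log_le {k : ℕ} {lam : ℝ} (hlam : 0 < lam) (hlamB : lam ≤ lamB k) :
    3 * Real.log k ≤ Real.log (lam ^ (-xiZero)) := by
  rw [log_rpow_neg_xiZero hlam]
  have h := Real.log_le_log hlam hlamB
  rw [lamB, Real.log_exp, le_div_iff₀ xiZero_pos] at h
  linarith

theorem one_le_log {k : ℕ} (hk : 3 ≤ k) : 1 ≤ Real.log k := by
  have hk' : (3 : ℝ) ≤ k := by exact_mod_cast hk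
  rw [Real.le_log_iff_exp_le (by linarith)]
  linarith [Real.exp_one_lt_d9]

/-- The degree of the approximating Bernstein polynomial. -/
theorem exists_degree {k : ℕ} (hk : 3 ≤ k) {lam : ℝ} (hlam : 0 < lam) (hlamB : lam ≤ lamB k) :
    ∃ n : ℕ, 3 ≤ n ∧ Real.log (lam ^ (-xiZero)) ≤ (n + 1) * Real.log k ∧ lam * (k : ℝ) ^ n ≤ 1 := by
  set L := Real.log (lam ^ (-xiZero)) with hL
  have hlog := one_le_log hk
  have hk0 : (0 : ℝ) < k := by
    have : 0 < k := by omega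
    exact_mod_cast this
  have h3 : 3 ≤ L / Real.log k := by
    rw [le_div_iff₀ (by linarith)]
    exact three_mul_log_le hlam hlamB
  -- The factor 3 in the exponent of `λ_𝔹` is what makes this degree at least 3. Of `ξ₀`, the bound
  -- `λ k^n ≤ 1` uses only `0 < ξ₀ ≤ 1`.
  refine ⟨⌊L / Real.log k⌋₊, Nat.le_floor (by exact_mod_cast h3), ?_, ?_⟩
  · rw [← div_le_iff₀ (by linarith)]
    exact (Nat.lt_floor_add_one _).le
  · have h1 : (⌊L / Real.log k⌋₊ : ℝ) * Real.log k ≤ L := by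
      rw [← le_div_iff₀ (by linarith)]
      exact Nat.floor_le (by linarith)
    rw [log_rpow_neg_xiZero hlam] at hL
    have h2 : Real.log lam ≤ 0 := by
      have : 0 ≤ L := le_trans (by positivity) (three_mul_log_le hlam hlamB)
      rw [hL] at this
      have hxi := xiZero_pos
      nlinarith
    have h4 : L ≤ -Real.log lam := by
      rw [hL]
      nlinarith [xiZero_le_one]
    rw [← Real.log_nonpos_iff (by positivity), Real.log_mul hlam.ne' (by positivity), Real.log_pow]
    linarith

theorem error_le {k : ℕ} (hk : 3 ≤ k) {lam : ℝ} (hlam : 0 < lam) (hlamB : lam ≤ lamB k) :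
    ∃ n : ℕ, n ≠ 0 ∧ ∀ K M : ℝ, 0 ≤ K → 0 ≤ M →
      2 * (2 * √((k : ℝ) - 1) + lamB k) * K / √n
          + M * (2 ^ n * (n * (lam / (2 * (2 * √((k : ℝ) - 1) + lamB k)))))
        ≤ (6 / 5 * (2 * (2 * √(k : ℝ) + lamB k) * √(Real.log k)) * K + M / 2)
          / √(Real.log (lam ^ (-xiZero))) := by
  obtain ⟨n, hn, hL, hpow⟩ := exists_degree hk hlam hlamB
  have hlog := one_le_log hk
  have hk' : (3 : ℝ) ≤ k := by exact_mod_cast hk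
  have hn' : (3 : ℝ) ≤ n := by exact_mod_cast hn
  have hL3 := three_mul_log_le hlam hlamB
  set L := Real.log (lam ^ (-xiZero))
  have hL0 : 0 < L := by linarith
  have hB := lamB_pos k
  have hq : √((k : ℝ) - 1) ≤ √(k : ℝ) := Real.sqrt_le_sqrt (by linarith)
  have hq0 : 0 < √((k : ℝ) - 1) := Real.sqrt_pos.2 (by linarith)
  have hq2 : √((k : ℝ) - 1) ^ 2 = k - 1 := Real.sq_sqrt (by linarith)
  set q := √((k : ℝ) - 1)
  refine ⟨n, by omega, fun K M hK hM => ?_⟩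
  have hsL : 0 < √L := Real.sqrt_pos.2 hL0
  have hsn : 0 < √(n : ℝ) := Real.sqrt_pos.2 (by linarith)
  rw [add_div]
  refine add_le_add ?_ ?_
  · rw [div_le_div_iff₀ hsn hsL]
    -- As `n ≥ 3`, `n + 1 ≤ (4/3) n ≤ (6/5)² n`.
    have h1 : √L ≤ 6 / 5 * (√(Real.log k) * √(n : ℝ)) := by
      rw [← Real.sqrt_mul (by linarith), Real.sqrt_le_left (by positivity), mul_pow,
        Real.sq_sqrt (by positivity)]
      nlinarith
    calc 2 * (2 * q + lamB k) * K * √L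
        ≤ 2 * (2 * √(k : ℝ) + lamB k) * K * (6 / 5 * (√(Real.log k) * √(n : ℝ))) := by gcongr
      _ = _ := by ring
  · have h2 : (2 ^ n * (n * lam)) ^ 2 * L ≤ (2 * q) ^ 2 := by
      have h4 : (4 : ℝ) ^ n * lam ^ 2 ≤ (4 / 9) ^ n := by
        rw [div_pow, le_div_iff₀ (by positivity), show (9 : ℝ) = 3 ^ 2 by norm_num, ← pow_mul,
          mul_comm 2 n, pow_mul, mul_assoc, ← mul_pow]
        have h5 : lam * 3 ^ n ≤ 1 := le_trans (by gcongr) hpow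
        have h6 : (lam * 3 ^ n) ^ 2 ≤ 1 := pow_le_one₀ (by positivity) h5
        nlinarith [pow_pos (show (0 : ℝ) < 4 by norm_num) n]
      have h7 := sq_mul_succ_mul_pow_le hn
      calc (2 ^ n * (n * lam)) ^ 2 * L = n ^ 2 * (4 ^ n * lam ^ 2) * L := by
            rw [mul_pow, mul_pow, ← pow_mul, mul_comm n 2, pow_mul]
            rw [show (2 : ℝ) ^ 2 = 4 by norm_num]
            ring
        _ ≤ n ^ 2 * (4 / 9) ^ n * ((n + 1) * Real.log k) := by gcongr
        _ = (n ^ 2 * (n + 1) * (4 / 9) ^ n) * Real.log k := by ring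
        _ ≤ 4 * (k - 1) := by
            gcongr
            exact Real.log_le_sub_one_of_pos (by linarith)
        _ = _ := by rw [mul_pow, hq2]; norm_num
    have h3 : 2 ^ n * (n * lam) * √L ≤ 2 * q + lamB k := by
      refine le_trans (le_of_sq_le_sq ?_ (by positivity)) (le_add_of_nonneg_right hB.le)
      rwa [mul_pow, Real.sq_sqrt hL0.le]
    rw [le_div_iff₀ hsL]
    calc M * (2 ^ n * (n * (lam / (2 * (2 * q + lamB k))))) * √L
        = M * ((2 ^ n * (n * lam) * √L) / (2 * (2 * q + lamB k))) := by ring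
      _ ≤ M * ((2 * q + lamB k) / (2 * (2 * q + lamB k))) := by gcongr
      _ = M / 2 := by field_simp

end Numerics

/-! ### Comparison of the density of states functionals -/

section Comparison

variable {V : Type*} {G : SimpleGraph V} [G.LocallyFinite] {k : ℕ}

theorem norm_hamiltonian_le_of_isTree (hG : G.IsTree) (hk : 2 ≤ k)
    (hreg : G.IsRegularOfDegree k) (lam : ℝ) (ω : Config V) :
    ‖hamiltonian hreg lam ω‖ ≤ 2 * √((k : ℝ) - 1) + |lam| := by
  have h2 : ‖potential ω‖ ≤ 1 := LinearMap.mkContinuous_norm_le _ (by positivity) _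
  refine (norm_add_le _ _).trans (add_le_add (norm_laplacian_le hG hk hreg) ?_)
  rw [norm_smul, Complex.norm_real, Real.norm_eq_abs]
  exact mul_le_of_le_one_right (abs_nonneg _) h2

theorem hamiltonian_zero (hreg : G.IsRegularOfDegree k) (ω : Config V) :
    hamiltonian hreg 0 ω = laplacian hreg := by
  simp [hamiltonian]

theorem norm_hamiltonian_sub_le (hreg : G.IsRegularOfDegree k) (lam : ℝ) (ω : Config V) :
    ‖hamiltonian hreg lam ω - hamiltonian hreg 0 ω‖ ≤ |lam| := by
  have h2 : ‖potential ω‖ ≤ 1 := LinearMap.mkContinuous_norm_le _ (by positivity) _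
  rw [hamiltonian_zero, hamiltonian, add_sub_cancel_left, norm_smul, Complex.norm_real,
    Real.norm_eq_abs]
  exact mul_le_of_le_one_right (abs_nonneg _) h2

theorem localTrace_congr (hreg : G.IsRegularOfDegree k) (o : V) {lam R : ℝ} {ω : Config V}
    (hR : ‖hamiltonian hreg lam ω‖ ≤ R) {f g : ℝ → ℝ} (h : Set.EqOn f g (Set.Icc (-R) R)) :
    localTrace hreg o lam f ω = localTrace hreg o lam g ω := by
  rw [localTrace, localTrace, matrixElement, matrixElement,
    cfc_congr fun x hx => h (spectrum_subset _ hR hx)]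

theorem dosFunctional_congr (hreg : G.IsRegularOfDegree k) (o : V)
    (μ : Measure (Set.Icc (-1 : ℝ) 1)) [IsProbabilityMeasure μ] {lam R : ℝ}
    (hR : ∀ ω : Config V, ‖hamiltonian hreg lam ω‖ ≤ R) {f g : ℝ → ℝ}
    (h : Set.EqOn f g (Set.Icc (-R) R)) :
    dosFunctional hreg o μ lam f = dosFunctional hreg o μ lam g :=
  integral_congr_ae (Filter.Eventually.of_forall fun ω => localTrace_congr hreg o (hR ω) h)

theorem abs_dosFunctional_sub_le_of_continuous (hreg : G.IsRegularOfDegree k) (o : V)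
    (μ : Measure (Set.Icc (-1 : ℝ) 1)) [IsProbabilityMeasure μ] {lam R K M : ℝ} (hR0 : 0 < R)
    (hR : ∀ ω : Config V, ‖hamiltonian hreg lam ω‖ ≤ R)
    (hR' : ∀ ω : Config V, ‖hamiltonian hreg 0 ω‖ ≤ R) {f : ℝ → ℝ} (hfc : Continuous f)
    (hf : ∀ x ∈ Set.Icc (-R) R, ∀ y ∈ Set.Icc (-R) R, |f x - f y| ≤ K * |x - y|)
    (hM : ∀ x ∈ Set.Icc (-R) R, |f x| ≤ M) {n : ℕ} (hn : n ≠ 0) :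
    |dosFunctional hreg o μ lam f - dosFunctional hreg o μ 0 f|
      ≤ 2 * R * K / √n + M * (2 ^ n * (n * (|lam| / (2 * R)))) := by
  have hM0 : 0 ≤ M := (abs_nonneg _).trans (hM 0 (by constructor <;> linarith))
  have : Nontrivial (Ell2 V) := ⟨delta o, 0, fun h => by simpa [h] using norm_delta o⟩
  rw [dosFunctional, dosFunctional, ← integral_sub (integrable_localTrace hreg o μ lam hfc)
    (integrable_localTrace hreg o μ 0 hfc), ← Real.norm_eq_abs]
  refine (norm_integral_le_of_norm_le_const (C := 2 * R * K / √n
    + M * (2 ^ n * (n * (|lam| / (2 * R))))) (Filter.Eventually.of_forall fun ω => ?_)).trans ?_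
  · refine (abs_matrixElement_sub_le _ _ (norm_delta o) f).trans ?_
    refine (norm_cfc_sub_cfc_le (isSelfAdjoint_hamiltonian hreg lam ω)
      (isSelfAdjoint_hamiltonian hreg 0 ω) hR0 (hR ω) (hR' ω) hf hM hn).trans ?_
    gcongr
    exact norm_hamiltonian_sub_le hreg lam ω
  · simp

theorem energyInterval_eq (k : ℕ) :
    energyInterval k = Set.Icc (-(2 * √((k : ℝ) - 1) + lamB k)) (2 * √((k : ℝ) - 1) + lamB k) := by
  rw [energyInterval]
  congr 1
  ring

theorem norm_hamiltonian_le_lamB (hG : G.IsTree) (hk : 2 ≤ k) (hreg : G.IsRegularOfDegree k)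
    {lam : ℝ} (hlam : 0 ≤ lam) (hlamB : lam ≤ lamB k) (ω : Config V) :
    ‖hamiltonian hreg lam ω‖ ≤ 2 * √((k : ℝ) - 1) + lamB k := by
  have := norm_hamiltonian_le_of_isTree hG hk hreg lam ω
  rw [abs_of_nonneg hlam] at this
  linarith

/-- A quantitative comparison of the density of states of the Anderson model with that of the free
Laplacian, separating the Lipschitz constant `K` and the supremum `M` of the test function. -/
theorem abs_dosFunctional_sub_le (hG : G.IsTree) (hk : 3 ≤ k) (hreg : G.IsRegularOfDegree k)
    (o : V) (μ : Measure (Set.Icc (-1 : ℝ) 1)) [IsProbabilityMeasure μ] {lam : ℝ} (hlam : 0 < lam)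
    (hlamB : lam ≤ lamB k) {f : ℝ → ℝ} {K M : ℝ} (hK : 0 ≤ K)
    (hf : ∀ x ∈ energyInterval k, ∀ y ∈ energyInterval k, |f x - f y| ≤ K * |x - y|)
    (hM : ∀ x ∈ energyInterval k, |f x| ≤ M) :
    |dosFunctional hreg o μ lam f - dosFunctional hreg o μ 0 f|
      ≤ (6 / 5 * (2 * (2 * √(k : ℝ) + lamB k) * √(Real.log k)) * K + M / 2)
          / √(Real.log (lam ^ (-xiZero))) := by
  rw [energyInterval_eq] at hf hM
  have hB := lamB_pos k
  have hN := norm_hamiltonian_le_lamB hG (by omega) hreg hlam.le hlamB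
  have hN' := norm_hamiltonian_le_lamB hG (by omega) hreg le_rfl hB.le
  obtain ⟨n, hn, herr⟩ := error_le hk hlam hlamB
  set R := 2 * √((k : ℝ) - 1) + lamB k
  have hR : 0 < R := by positivity
  have hle : -R ≤ R := by linarith
  have hM0 : 0 ≤ M := (abs_nonneg _).trans (hM 0 (by constructor <;> linarith))
  have hcont : ContinuousOn f (Set.Icc (-R) R) := by
    have : LipschitzOnWith K.toNNReal f (Set.Icc (-R) R) :=
      LipschitzOnWith.of_dist_le_mul fun x hx y hy => by
        rw [Real.coe_toNNReal _ hK]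
        exact hf x hx y hy
    exact this.continuousOn
  -- Integrability of the local trace is available for globally continuous functions, while `f` is
  -- controlled only on `I`; both functionals ignore values outside `I`.
  set g := Set.IccExtend hle ((Set.Icc (-R) R).domRestrict f) with hg
  have hgc : Continuous g := hcont.domRestrict.Icc_extend'
  have hgf : Set.EqOn f g (Set.Icc (-R) R) := fun x hx => by
    rw [hg, Set.IccExtend_of_mem hle _ hx, Set.domRestrict_apply]
  rw [dosFunctional_congr hreg o μ hN hgf, dosFunctional_congr hreg o μ hN' hgf]
  refine (abs_dosFunctional_sub_le_of_continuous hreg o μ (K := K) (M := M) hR hN hN' hgc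
    (fun x hx y hy => ?_) (fun x hx => ?_) hn).trans ?_
  · rw [← hgf hx, ← hgf hy]
    exact hf x hx y hy
  · rw [← hgf hx]
    exact hM x hx
  · rw [abs_of_pos hlam]
    exact herr K M hK hM0

end Comparison

/-! ### Ramps and compactly supported cutoffs -/

section Cutoff

/-- The continuous function that is `1` on `(-∞, a]`, `0` on `[a + δ, ∞)` and linear in between. -/
def ramp (a δ x : ℝ) : ℝ := max 0 (min 1 ((a + δ - x) / δ))

theorem continuous_ramp (a δ : ℝ) : Continuous (ramp a δ) := by
  unfold ramp
  fun_prop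

theorem ramp_nonneg (a δ x : ℝ) : 0 ≤ ramp a δ x := le_max_left _ _

theorem ramp_le_one (a δ x : ℝ) : ramp a δ x ≤ 1 := max_le zero_le_one (min_le_left _ _)

theorem ramp_eq_one {a δ x : ℝ} (hδ : 0 < δ) (hx : x ≤ a) : ramp a δ x = 1 := by
  have : 1 ≤ (a + δ - x) / δ := by
    rw [le_div_iff₀ hδ]
    linarith
  rw [ramp, min_eq_left this, max_eq_right zero_le_one]

theorem ramp_eq_zero {a δ x : ℝ} (hδ : 0 < δ) (hx : a + δ ≤ x) : ramp a δ x = 0 := by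
  have : (a + δ - x) / δ ≤ 0 := div_nonpos_of_nonpos_of_nonneg (by linarith) hδ.le
  exact max_eq_left ((min_le_right _ _).trans this)

theorem abs_ramp_sub_le {a δ : ℝ} (hδ : 0 < δ) (x y : ℝ) :
    |ramp a δ x - ramp a δ y| ≤ δ⁻¹ * |x - y| := by
  unfold ramp
  rw [max_comm 0, max_comm 0]
  refine (abs_max_sub_max_le_abs (min 1 ((a + δ - x) / δ)) (min 1 ((a + δ - y) / δ)) 0).trans ?_
  refine (abs_min_sub_min_le_max _ _ _ _).trans ?_
  rw [sub_self, abs_zero, max_eq_right (abs_nonneg _), ← sub_div, abs_div, abs_of_pos hδ,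
    inv_mul_eq_div, abs_sub_comm x y]
  apply le_of_eq
  congr 2
  ring

/-- The product of a continuous function with a cutoff that equals `1` on `[-T, T]`. -/
def cutoff (T : ℝ) {f : ℝ → ℝ} (hf : Continuous f) : CompactlySupportedContinuousMap ℝ ℝ where
  toFun x := ramp T 1 |x| * f x
  continuous_toFun := ((continuous_ramp T 1).comp continuous_abs).mul hf
  hasCompactSupport' := by
    refine HasCompactSupport.intro (isCompact_Icc (a := -(T + 1)) (b := T + 1)) fun x hx => ?_
    have : T + 1 ≤ |x| := by
      by_contra! h
      exact hx (abs_le.1 h.le)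
    rw [ramp_eq_zero one_pos this, zero_mul]

theorem cutoff_apply (T : ℝ) {f : ℝ → ℝ} (hf : Continuous f) (x : ℝ) :
    cutoff T hf x = ramp T 1 |x| * f x := rfl

theorem cutoff_eq {T : ℝ} {f : ℝ → ℝ} (hf : Continuous f) {x : ℝ} (hx : x ∈ Set.Icc (-T) T) :
    cutoff T hf x = f x := by
  rw [cutoff_apply, ramp_eq_one one_pos (abs_le.2 hx), one_mul]

end Cutoff

/-! ### Integrated density of states -/

section IntegratedDensityOfStates

variable {V : Type*} {G : SimpleGraph V} [G.LocallyFinite] {k : ℕ}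

/-- The Riesz measure is tied to the functional only on compactly supported functions. Hence the
half-line is exhausted by compact intervals and `f` is cut off beyond the spectrum, where the
functional does not see it. -/
theorem dosMeasure_Iic_le (hreg : G.IsRegularOfDegree k) (o : V)
    (μ : Measure (Set.Icc (-1 : ℝ) 1)) [IsProbabilityMeasure μ] (lam : ℝ) {f : ℝ → ℝ}
    (hf : Continuous f) (hf0 : ∀ x, 0 ≤ f x) {E : ℝ} (hf1 : ∀ x ≤ E, f x = 1) :
    dosMeasure hreg o μ lam (Set.Iic E) ≤ ENNReal.ofReal (dosFunctional hreg o μ lam f) := by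
  have hunion : Set.Iic E = ⋃ n : ℕ, Set.Icc (-(n : ℝ)) E := by
    ext x
    simp only [Set.mem_Iic, Set.mem_iUnion, Set.mem_Icc]
    refine ⟨fun hx => ?_, fun ⟨n, hn⟩ => hn.2⟩
    obtain ⟨n, hn⟩ := exists_nat_ge (-x)
    exact ⟨n, by linarith, hx⟩
  have hmono : Monotone fun n : ℕ => Set.Icc (-(n : ℝ)) E := fun m n hmn =>
    Set.Icc_subset_Icc_left (neg_le_neg (by exact_mod_cast hmn))
  rw [hunion, hmono.measure_iUnion]
  refine iSup_le fun n => ?_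
  set T : ℝ := max n (max |E| (k + |lam|)) with hT
  have hTn : (n : ℝ) ≤ T := le_max_left _ _
  have hTE : E ≤ T := (le_abs_self E).trans ((le_max_left _ _).trans (le_max_right _ _))
  have hTk : k + |lam| ≤ T := (le_max_right _ _).trans (le_max_right _ _)
  have h1 : dosFunctional hreg o μ lam (cutoff T hf) = dosFunctional hreg o μ lam f :=
    dosFunctional_congr hreg o μ (fun ω => (norm_hamiltonian_le hreg lam ω).trans hTk)
      fun x hx => cutoff_eq hf hx
  rw [← h1]
  refine RealRMK.rieszMeasure_le_of_eq_one (dosPositive hreg o μ lam) (f := cutoff T hf)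
    (fun x => mul_nonneg (ramp_nonneg _ _ _) (hf0 x)) isCompact_Icc fun x hx => ?_
  rw [cutoff_eq hf ⟨by linarith [hx.1], hx.2.trans hTE⟩, hf1 x hx.2]

theorem dosMeasure_Iio_ne_top (hreg : G.IsRegularOfDegree k) (o : V)
    (μ : Measure (Set.Icc (-1 : ℝ) 1)) [IsProbabilityMeasure μ] (lam E : ℝ) :
    dosMeasure hreg o μ lam (Set.Iio E) ≠ ∞ :=
  ne_top_of_le_ne_top ENNReal.ofReal_ne_top ((measure_mono Set.Iio_subset_Iic_self).trans
    (dosMeasure_Iic_le hreg o μ lam (f := fun _ => 1) continuous_const (fun _ => zero_le_one)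
      fun _ _ => rfl))

theorem ids_le_dosFunctional_ramp (hreg : G.IsRegularOfDegree k) (o : V)
    (μ : Measure (Set.Icc (-1 : ℝ) 1)) [IsProbabilityMeasure μ] (lam E : ℝ) {δ : ℝ} (hδ : 0 < δ) :
    ids hreg o μ lam E ≤ dosFunctional hreg o μ lam (ramp E δ) := by
  refine ENNReal.toReal_le_of_le_ofReal
    (integral_nonneg fun ω => matrixElement_nonneg _ _ (ramp_nonneg E δ)) ?_
  exact (measure_mono Set.Iio_subset_Iic_self).trans (dosMeasure_Iic_le hreg o μ lam
    (continuous_ramp E δ) (ramp_nonneg E δ) fun x hx => ramp_eq_one hδ hx)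

theorem dosFunctional_ramp_le_ids (hreg : G.IsRegularOfDegree k) (o : V)
    (μ : Measure (Set.Icc (-1 : ℝ) 1)) [IsProbabilityMeasure μ] (lam E : ℝ) {δ : ℝ} (hδ : 0 < δ) :
    dosFunctional hreg o μ lam (ramp (E - δ) δ) ≤ ids hreg o μ lam E := by
  have hreg' : (dosMeasure hreg o μ lam).Regular := RealRMK.regular_rieszMeasure _
  have h1 : dosFunctional hreg o μ lam (cutoff (k + |lam|) (continuous_ramp (E - δ) δ))
      = dosFunctional hreg o μ lam (ramp (E - δ) δ) :=
    dosFunctional_congr hreg o μ (norm_hamiltonian_le hreg lam) fun x hx => cutoff_eq _ hx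
  rw [← h1, ← integral_dosMeasure, ids, ← integral_indicator_one measurableSet_Iio]
  refine integral_mono (CompactlySupportedContinuousMap.integrable _)
    ((integrable_indicator_iff measurableSet_Iio).2
      (integrableOn_const (dosMeasure_Iio_ne_top hreg o μ lam E))) fun x => ?_
  rw [cutoff_apply]
  by_cases hx : x < E
  · rw [Set.indicator_of_mem (Set.mem_Iio.2 hx), Pi.one_apply]
    exact mul_le_one₀ (ramp_le_one _ _ _) (ramp_nonneg _ _ _) (ramp_le_one _ _ _)
  · rw [Set.indicator_of_notMem (by simpa using hx), ramp_eq_zero (a := E - δ) hδ (by linarith),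
      mul_zero]

theorem dosFunctional_zero (hreg : G.IsRegularOfDegree k) (o : V)
    (μ : Measure (Set.Icc (-1 : ℝ) 1)) [IsProbabilityMeasure μ] (f : ℝ → ℝ) :
    dosFunctional hreg o μ 0 f = matrixElement (laplacian hreg) (delta o) f := by
  simp [dosFunctional, localTrace, hamiltonian_zero]

/-- The two ramps differ by at most 1, and only on `[E - δ, E + δ]`, where the kernel is at least
`1/(2δ)`. -/
theorem ramp_le_add_poissonKernel (E : ℝ) {δ : ℝ} (hδ : 0 < δ) (x : ℝ) :
    ramp E δ x ≤ ramp (E - δ) δ x + 2 * δ * poissonKernel E δ x := by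
  have hP : 0 ≤ poissonKernel E δ x := by
    unfold poissonKernel
    positivity
  rcases le_or_gt x (E - δ) with h | h
  · rw [ramp_eq_one hδ h]
    linarith [ramp_le_one E δ x, mul_nonneg hδ.le hP]
  rcases le_or_gt (E + δ) x with h' | h'
  · rw [ramp_eq_zero hδ h']
    linarith [ramp_nonneg (E - δ) δ x, mul_nonneg hδ.le hP]
  · have h1 : 1 ≤ 2 * δ * poissonKernel E δ x := by
      rw [poissonKernel, ← mul_div_assoc, one_le_div (by positivity)]
      nlinarith
    linarith [ramp_le_one E δ x, ramp_nonneg (E - δ) δ x]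

theorem dosFunctional_zero_ramp_le (hG : G.IsTree) (hk : 3 ≤ k) (hreg : G.IsRegularOfDegree k)
    (o : V) (μ : Measure (Set.Icc (-1 : ℝ) 1)) [IsProbabilityMeasure μ] (E : ℝ) {δ : ℝ}
    (hδ : 0 < δ) :
    dosFunctional hreg o μ 0 (ramp E δ) ≤ dosFunctional hreg o μ 0 (ramp (E - δ) δ) + 3 * δ := by
  rw [dosFunctional_zero, dosFunctional_zero]
  set A := laplacian hreg with hA
  have hsa : IsSelfAdjoint A := by
    rw [hA, ← hamiltonian_zero hreg fun _ => ⟨0, by simp⟩]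
    exact isSelfAdjoint_hamiltonian hreg 0 _
  have hP := matrixElement_laplacian_poissonKernel_le hG hk hreg o E hδ hsa
  have c1 := continuous_ramp E δ
  have c2 := continuous_ramp (E - δ) δ
  have c3 : Continuous (poissonKernel E δ) := continuous_poissonKernel hδ
  have h0 := matrixElement_nonneg A (delta o)
    (f := fun x => (ramp (E - δ) δ x + 2 * δ * poissonKernel E δ x) + (-1) * ramp E δ x)
    fun x => by linarith [ramp_le_add_poissonKernel E hδ x]
  rw [matrixElement_add A _ (by fun_prop) (by fun_prop), matrixElement_add A _ c2 (by fun_prop),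
    matrixElement_const_mul A _ _ c3, matrixElement_const_mul A _ _ c1] at h0
  nlinarith

theorem cB_nonneg (hk : 1 ≤ k) : 0 ≤ cB k := by
  unfold cB
  split_ifs <;> positivity

/-- The slack that absorbs every lower-order term: with `X` the last expression, `gammaTilde k ≥ 2X
+ 2` and `X ≥ 6`. The summand 4 covers `M/2` in (i) and `δ/2 + 3` in (ii). -/
theorem add_le_gammaTilde (hk : 3 ≤ k) :
    6 / 5 * (2 * (2 * √(k : ℝ) + lamB k) * √(Real.log k)) + 4 ≤ gammaTilde k ∧
      0 ≤ 2 * (2 * √(k : ℝ) + lamB k) * √(Real.log k) := by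
  have hk' : (3 : ℝ) ≤ k := by exact_mod_cast hk
  have hB := lamB_pos k
  have h1 : 1 ≤ √(Real.log k) := Real.one_le_sqrt.2 (one_le_log hk)
  have h2 : 3 / 2 ≤ √(k : ℝ) := Real.le_sqrt_of_sq_le (by linarith)
  have h3 : 1 ≤ bernsteinConst := by
    have : 2 ≤ √(6 : ℝ) := Real.le_sqrt_of_sq_le (by norm_num)
    unfold bernsteinConst
    linarith
  have h4 : 6 ≤ 2 * (2 * √(k : ℝ) + lamB k) * √(Real.log k) := by nlinarith
  refine ⟨?_, by linarith⟩
  have h5 : gammaTilde k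
      = 2 * ((2 * (2 * √(k : ℝ) + lamB k) * √(Real.log k)) * bernsteinConst + 1) := by
    rw [gammaTilde]
    ring
  rw [h5]
  nlinarith

theorem abs_ids_sub_le (hG : G.IsTree) (hk : 3 ≤ k) (hreg : G.IsRegularOfDegree k)
    (o : V) (μ : Measure (Set.Icc (-1 : ℝ) 1)) [IsProbabilityMeasure μ] {lam : ℝ} (hlam : 0 < lam)
    (hlamB : lam ≤ lamB k) (E : ℝ) :
    |ids hreg o μ lam E - ids hreg o μ 0 E|
      ≤ cTilde k / Real.log (lam ^ (-xiZero)) ^ (1 / 4 : ℝ) := by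
  have hL : 1 ≤ Real.log (lam ^ (-xiZero)) := by
    linarith [three_mul_log_le hlam hlamB, one_le_log hk]
  have hdos : ∀ a δ : ℝ, 0 < δ → _ := fun a δ hδ =>
    abs_le.1 (abs_dosFunctional_sub_le hG hk hreg o μ hlam hlamB (f := ramp a δ) (M := 1)
      (inv_nonneg.2 hδ.le) (fun x _ y _ => abs_ramp_sub_le hδ x y)
      fun x _ => abs_le.2 ⟨by linarith [ramp_nonneg a δ x], ramp_le_one a δ x⟩)
  obtain ⟨hγ, hX0⟩ := add_le_gammaTilde hk
  set L := Real.log (lam ^ (-xiZero))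
  set X := 2 * (2 * √(k : ℝ) + lamB k) * √(Real.log k)
  set t := L ^ (1 / 4 : ℝ) with ht
  have ht1 : 1 ≤ t := Real.one_le_rpow hL (by norm_num)
  have ht2 : √L = t ^ 2 := by
    rw [ht, Real.sqrt_eq_rpow, ← Real.rpow_natCast, ← Real.rpow_mul (by linarith)]
    norm_num
  have ht0 : 0 < t := by linarith
  have hδ : 0 < t⁻¹ := inv_pos.2 ht0
  -- With `√L = t²`, the ramp slope `1/δ = t` turns the main error into order `1/t`, the same as the
  -- smoothing error `3δ`.
  set δ := t⁻¹ with hδt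
  have herr : (6 / 5 * X * δ⁻¹ + 1 / 2) / √L + 3 * δ ≤ cTilde k / t := by
    have h1 : (6 / 5 * X * δ⁻¹ + 1 / 2) / √L + 3 * δ = (6 / 5 * X + 1 / 2 * δ + 3) / t := by
      rw [ht2, hδt]
      field_simp
    rw [h1, cTilde]
    have hδ1 : δ ≤ 1 := inv_le_one_of_one_le₀ ht1
    have := cB_nonneg (k := k) (by omega)
    exact div_le_div_of_nonneg_right (by linarith) ht0.le
  have h0 := dosFunctional_zero_ramp_le hG hk hreg o μ E hδ
  have hu := hdos E δ hδ
  have hl := hdos (E - δ) δ hδ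
  have u1 := ids_le_dosFunctional_ramp hreg o μ lam E hδ
  have u2 := ids_le_dosFunctional_ramp hreg o μ 0 E hδ
  have l1 := dosFunctional_ramp_le_ids hreg o μ lam E hδ
  have l2 := dosFunctional_ramp_le_ids hreg o μ 0 E hδ
  -- Each direction bounds one `ids` from above and the other from below by ramps, compares the `λ`
  -- and free functionals on a single ramp, and passes between the ramps only at `λ = 0`.
  refine (abs_le.2 ⟨?_, ?_⟩ : _ ≤ (6 / 5 * X * δ⁻¹ + 1 / 2) / √L + 3 * δ).trans herr
  · linarith [hl.1]
  · linarith [hu.2]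

end IntegratedDensityOfStates

/-! ### The Lipschitz norm -/

section LipschitzNorm

theorem isLip_bounds {a b : ℝ} {f : ℝ → ℝ} (hf : IsLip (Set.Icc a b) f) :
    ∃ K M : ℝ, 0 ≤ K ∧ 0 ≤ M ∧ lipNorm (Set.Icc a b) f = M + K ∧
      (∀ x ∈ Set.Icc a b, ∀ y ∈ Set.Icc a b, |f x - f y| ≤ K * |x - y|) ∧
      ∀ x ∈ Set.Icc a b, |f x| ≤ M := by
  obtain ⟨C, hC⟩ := hf
  have hC' : ∀ x ∈ Set.Icc a b, ∀ y ∈ Set.Icc a b, |f x - f y| ≤ C * |x - y| := hC.dist_le_mul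
  refine ⟨sSup {t | ∃ x ∈ Set.Icc a b, ∃ y ∈ Set.Icc a b, x ≠ y ∧ t = |f x - f y| / |x - y|},
    sSup {t | ∃ x ∈ Set.Icc a b, t = |f x|}, ?_, ?_, rfl, fun x hx y hy => ?_, fun x hx => ?_⟩
  -- Nonnegativity also covers an empty set, whose `sSup` is `0`. Boundedness, without which `sSup`
  -- would be a meaningless `0`, is supplied from `hC` in the last two goals.
  · refine Real.sSup_nonneg ?_
    rintro _ ⟨x, -, y, -, -, rfl⟩
    positivity
  · refine Real.sSup_nonneg ?_
    rintro _ ⟨x, -, rfl⟩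
    positivity
  · rcases eq_or_ne x y with rfl | hxy
    · simp
    · rw [← div_le_iff₀ (abs_pos.2 (sub_ne_zero.2 hxy))]
      refine le_csSup ⟨C, ?_⟩ ⟨x, hx, y, hy, hxy, rfl⟩
      rintro _ ⟨u, hu, v, hv, huv, rfl⟩
      rw [div_le_iff₀ (abs_pos.2 (sub_ne_zero.2 huv))]
      exact hC' u hu v hv
  · obtain ⟨B, hB⟩ := isCompact_Icc.exists_bound_of_continuousOn hC.continuousOn
    refine le_csSup ⟨B, ?_⟩ ⟨x, hx, rfl⟩
    rintro _ ⟨u, hu, rfl⟩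
    exact hB u hu

end LipschitzNorm

end BetheAnderson

end

/-! ### Conclusion -/

theorem theorem6p4 {V : Type*} (G : SimpleGraph V) [G.LocallyFinite] (hG : G.IsTree)
    (k : ℕ) (hk : 3 ≤ k) (hreg : G.IsRegularOfDegree k) (o : V)
    (μ : MeasureTheory.Measure (Set.Icc (-1 : ℝ) 1)) [MeasureTheory.IsProbabilityMeasure μ]
    (lam : ℝ) (hlam : 0 < lam) (hlamB : lam ≤ BetheAnderson.lamB k) :
    (∀ f : ℝ → ℝ, BetheAnderson.IsLip (BetheAnderson.energyInterval k) f →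
      |BetheAnderson.dosFunctional hreg o μ lam f - BetheAnderson.dosFunctional hreg o μ 0 f|
        ≤ BetheAnderson.gammaTilde k
            * BetheAnderson.lipNorm (BetheAnderson.energyInterval k) f
          / √(Real.log (lam ^ (-(2 * Real.exp 1 / (1 + 2 * Real.exp 1)))))) ∧
    (∀ E : ℝ,
      |BetheAnderson.ids hreg o μ lam E - BetheAnderson.ids hreg o μ 0 E|
        ≤ BetheAnderson.cTilde k
          / Real.log (lam ^ (-(2 * Real.exp 1 / (1 + 2 * Real.exp 1)))) ^ (1 / 4 : ℝ)) := by
  refine ⟨fun f hf => ?_, BetheAnderson.abs_ids_sub_le hG hk hreg o μ hlam hlamB⟩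
  obtain ⟨K, M, hK, hM, hnorm, hfK, hfM⟩ := BetheAnderson.isLip_bounds hf
  refine (BetheAnderson.abs_dosFunctional_sub_le hG hk hreg o μ hlam hlamB hK hfK hfM).trans ?_
  obtain ⟨hγ, hX⟩ := BetheAnderson.add_le_gammaTilde hk
  have h : 6 / 5 * (2 * (2 * √(k : ℝ) + BetheAnderson.lamB k) * √(Real.log k)) * K + M / 2
      ≤ BetheAnderson.gammaTilde k * BetheAnderson.lipNorm (BetheAnderson.energyInterval k) f := by
    have hnorm' : BetheAnderson.lipNorm (BetheAnderson.energyInterval k) f = M + K := hnorm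
    rw [hnorm']
    nlinarith [mul_nonneg hX hM]
  exact div_le_div_of_nonneg_right h (Real.sqrt_nonneg _)
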